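/- Let $\|\cdot\|$ be the Euclidean norm on $\mathbb{R}^n$. For $h:\mathbb{R}^n\to(-\infty,\infty]$ write $\operatorname{dom}h=\{x: h(x)<\infty\}$; $h$ is called $m$-weakly convex if $h+\frac m2\|\cdot\|^2$ is convex on its (convex) effective domain, and $\partial h(x)$ denotes the Fréchet subdifferential, i.e. the set of all $g$ with $h(y)\ge h(x)+\langle g,y-x\rangle+o(\|y-x\|)$ as $y\to x$. For $\theta>0$, $\mathrm{env}_{\theta h}(x)=\inf_{y}\,h(y)+\frac1{2\theta}\|x-y\|^2$. Let $(\Omega,\mathcal F,\mathbb P)$ be a probability space, let $\xi^0,\xi^1,\dots$ be random elements of a measurable space $\Xi$, and let $\mathcal F_k=\sigma(\xi^0,\dots,\xi^{k-1})$. Let $f:\mathbb{R}^n\to\mathbb{R}$, $\varphi:\mathbb{R}^n\to(-\infty,\infty]$, $\psi=f+\varphi$, and let $f_x(y,\xi)\in\mathbb{R}$ ($x,y\in\mathbb{R}^n$, $\xi\in\Xi$) be a family of model functions. Let $\{x^k\}_{k\ge0}$ be adapted to $\{\mathcal F_k\}$ and generated by the stochastic model-based method $$x^{k+1}\in\operatorname{argmin}_{y\in\mathbb{R}^n}\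 f_{x^k}(y,\xi^k)+\varphi(y)+\frac{1}{2\alpha_k}\|y-x^k\|^2\qquad\text{a.s. for all }k .$$ Let $\eta,\rho,\tau,\mathsf C,\mathsf D,\mathsf L_\varphi,\mathsf L_f,\mathsf L\ge0$ and $\bar f,\bar\varphi\in\mathbb{R}$, and assume: (E.1) for all $k$, the random variables $f_{x^k}(x^k,\xi^k)$ and $f_{x^k}(y,\xi^k)$, $y\in\operatorname{dom}\varphi$, are integrable, $\mathbb{E}[f_{x^k}(x^k,\xi^k)\mid\mathcal F_k]=f(x^k)$ a.s., and $\mathbb{E}[f_{x^k}(y,\xi^k)-f(y)\mid\mathcal F_k]\le\frac\tau2\|x^k-y\|^2$ a.s. for every $y\in\operatorname{dom}\varphi$; (E.2) for all $k$, $y\mapsto f_{x^k}(y,\xi^k)$ is $\eta$-weakly convex a.s.; (E.3) there are square-integrable random vectors $g^k$ with $g^k\in\partial f_{x^k}(\cdot,\xi^k)(x^k)$ a.s. and $\mathbb{E}[\|g^k\|^2\mid\mathcal F_k]\le\mathsf C[f(x^k)-\bar f]+\mathsf D$ a.s. for all $k$; (E.4) $\varphi$ is $\rho$-weakly convex, proper,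 lower semicontinuous, $\mathsf L_\varphi$-Lipschitz continuous on $\operatorname{dom}\varphi$, and $\varphi\ge\bar\varphi$ on $\operatorname{dom}\varphi$; (E.5) $\alpha_k>0$ and $\alpha_k\eta<1$ for all $k$ (so that every subproblem has a minimizer), $\sum_k\alpha_k=\infty$ and $\sum_k\alpha_k^2<\infty$. Assume moreover that one of the following holds: (F.1) $f\ge\bar f$ on $\operatorname{dom}\varphi$ and $f$ is $\mathsf L_f$-Lipschitz continuous on $\operatorname{dom}\varphi$; or (F.2) $f\ge\bar f$ on $\mathbb{R}^n$, and $f$ is differentiable with $\mathsf L$-Lipschitz continuous gradient on $\mathbb{R}^n$. Finally, let $\psi$ be $(\eta+\rho+\tau)$-weakly convex (so that $\mathrm{env}_{\theta\psi}$ is differentiable for the $\theta$ below). Then, for all $\theta\in(0,(\eta+\rho+\tau)^{-1})$ (with $0^{-1}=\infty$), the function $\mathrm{env}_{\theta\psi}$ is differentiable on $\mathbb{R}^n$, each $\|\nabla\mathrm{env}_{\theta\psi}(x^k)\|$ is integrable, $\lim_{k\to\infty}\mathbb{E}[\|\nabla\mathrm{env}_{\theta\psi}(x^k)\|]=0$,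 and $\lim_{k\to\infty}\|\nabla\mathrm{env}_{\theta\psi}(x^k)\|=0$ almost surely. -/

import Mathlib

open MeasureTheory Filter Topology
open scoped NNReal

/-- The effective domain `{x | h x < ∞}` of an extended-real-valued function. -/
def effDom {E : Type*} (h : E → EReal) : Set E := {x | h x < ⊤}

/-- `h : E → (-∞, ∞]` is `m`-weakly convex: `h + (m / 2) ‖·‖²` is convex on the effective domain
of `h` (in particular, the effective domain is a convex set). -/
def WeaklyConvex {E : Type*} [NormedAddCommGroup E] [NormedSpace ℝ E] (m : ℝ) (h : E → EReal) :
    Prop :=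
  ConvexOn ℝ (effDom h) (fun x => (h x).toReal + m / 2 * ‖x‖ ^ 2)

/-- The Fréchet (regular) subdifferential of a real-valued function at `x`: all `g` with
`h y ≥ h x + ⟪g, y - x⟫ + o(‖y - x‖)` as `y → x`. -/
def frechetSubdiff {E : Type*} [NormedAddCommGroup E] [InnerProductSpace ℝ E] (h : E → ℝ) (x : E) :
    Set E :=
  {g | ∀ ε : ℝ, 0 < ε → ∀ᶠ y in 𝓝 x, h x + inner ℝ g (y - x) - ε * ‖y - x‖ ≤ h y}

/-- The Moreau envelope `x ↦ inf_y h y + ‖x - y‖² / (2 θ)`, as a real number. -/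
noncomputable def moreauEnv {E : Type*} [NormedAddCommGroup E] (θ : ℝ) (h : E → EReal) (x : E) :
    ℝ :=
  (⨅ y : E, h y + ((1 / (2 * θ) * ‖x - y‖ ^ 2 : ℝ) : EReal)).toReal

/-- The filtration `ℱ k = σ(ξ 0, …, ξ (k - 1))` generated by the past samples. -/
def sampleFiltration {Ω Ξ : Type*} [mΩ : MeasurableSpace Ω] [mΞ : MeasurableSpace Ξ]
    (ξ : ℕ → Ω → Ξ) (hξ : ∀ k, Measurable (ξ k)) : Filtration ℕ mΩ where
  seq k := ⨆ i : ℕ, ⨆ _ : i < k, MeasurableSpace.comap (ξ i) mΞ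
  mono' _ _ hkl := iSup_mono fun _ => iSup_mono' fun hi => ⟨lt_of_lt_of_le hi hkl, le_rfl⟩
  le' _ := iSup_le fun i => iSup_le fun _ => (hξ i).comap_le

/-- The composite objective `ψ = f + φ`. -/
noncomputable def compositeObj {E : Type*} (f : E → ℝ) (φ : E → EReal) (x : E) : EReal :=
  (f x : EReal) + φ x

/-- `f` is bounded from below by `fbar` and `Lf`-Lipschitz continuous on `dom φ`. -/
def LipschitzScenario {E : Type*} [NormedAddCommGroup E] (f : E → ℝ) (φ : E → EReal)
    (fbar : ℝ) (Lf : ℝ≥0) : Prop :=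
  (∀ x ∈ effDom φ, fbar ≤ f x) ∧ LipschitzOnWith Lf f (effDom φ)

/-- `f` is bounded from below by `fbar` and differentiable with `L`-Lipschitz gradient on the
whole space. -/
def SmoothScenario {E : Type*} [NormedAddCommGroup E] [InnerProductSpace ℝ E] [CompleteSpace E]
    (f : E → ℝ) (fbar : ℝ) (L : ℝ≥0) : Prop :=
  (∀ x, fbar ≤ f x) ∧ Differentiable ℝ f ∧ LipschitzWith L (gradient f)

/-! The Moreau envelope of `ψ` serves as a Lyapunov function. Below the threshold for `θ` the
proximal map `P` is single-valued and Lipschitz, and the envelope has the Lipschitz gradient `Γ =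
θ⁻¹ (x - P x)`. Using `P x` as competitor both in the subproblem and in the envelope at the new
iterate (`IsProxMap.env_step_descent`) yields a decrease of order `α ‖Γ‖²`, an error of order `α²
(‖g‖ + Lφ)²`, and a model error whose conditional mean is nonpositive.

The noise is not uniformly bounded: its conditional second moment may grow with `f - fbar`. In both
scenarios this gap is controlled by the envelope gap `e` (`exists_gap_le`), so the error only
multiplies `e` by `1 + c α²`, and `e` is an almost supermartingale. Hence `e` is bounded in mean and
along almost every path, and `∑ α E‖Γ‖²` is finite.

Since `∑ α = ∞`, this alone only makes the lower limit of `E‖Γ‖` vanish. Full convergence comes from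
`tendsto_zero_of_summable_mul_sq`, which needs increments `d` with `∑ d²` and `∑ d a²` finite. It is
used once for `a = E‖Γ‖` with `d` proportional to `α`, and once pathwise for `a = ‖Γ‖` with `d`
proportional to `α (‖g‖ + 1)`.

A measure-theoretic gap remains: accuracy of the model is assumed at deterministic points, yet it is
needed at the random point `P x`. `setIntegral_comp_nonpos` closes it by finite-valued approximation
and Fatou's lemma. -/

lemma le_of_forall_mem_Ioo_le_add_mul {a b c : ℝ}
    (h : ∀ t : ℝ, 0 < t → t < 1 → a ≤ b + t * c) : a ≤ b := by
  have h1 : Tendsto (fun t : ℝ => b + t * c) (𝓝[>] 0) (𝓝 (b + 0 * c)) :=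
    ((continuous_const.add (continuous_id.mul continuous_const)).tendsto 0).mono_left
      nhdsWithin_le_nhds
  rw [zero_mul, add_zero] at h1
  refine ge_of_tendsto h1 ?_
  filter_upwards [Ioo_mem_nhdsGT (zero_lt_one' ℝ)] with t ht using h t ht.1 ht.2

/-! ### Weakly convex functions and global subgradient inequalities -/

section Convex

variable {E : Type*} [NormedAddCommGroup E] [InnerProductSpace ℝ E]

lemma norm_lineMap_sub_sq (x y z : E) (t : ℝ) :
    ‖x + t • (y - x) - z‖ ^ 2
      = (1 - t) * ‖x - z‖ ^ 2 + t * ‖y - z‖ ^ 2 - t * (1 - t) * ‖y - x‖ ^ 2 := by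
  have e1 : x + t • (y - x) - z = (x - z) + t • (y - x) := by abel
  have e2 : y - z = (x - z) + (y - x) := by abel
  rw [e1, e2, norm_add_sq_real, norm_add_sq_real, norm_smul, inner_smul_right, mul_pow,
    Real.norm_eq_abs, sq_abs]
  ring

lemma ConvexOn.weak_lineMap_le {K : Set E} {h : E → ℝ} {m : ℝ}
    (hh : ConvexOn ℝ K fun y => h y + m / 2 * ‖y‖ ^ 2) {x y : E} (hx : x ∈ K) (hy : y ∈ K)
    {t : ℝ} (ht0 : 0 ≤ t) (ht1 : t ≤ 1) :
    x + t • (y - x) ∈ K ∧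
      h (x + t • (y - x)) ≤ (1 - t) * h x + t * h y + m / 2 * (t * (1 - t) * ‖y - x‖ ^ 2) := by
  have e : (1 - t) • x + t • y = x + t • (y - x) := by
    rw [sub_smul, smul_sub, one_smul]; abel
  have h1 := hh.2 hx hy (sub_nonneg.2 ht1) ht0 (by ring)
  have h2 := hh.1 hx hy (sub_nonneg.2 ht1) ht0 (by ring)
  rw [e] at h1 h2
  have h3 := norm_lineMap_sub_sq x y 0 t
  simp only [sub_zero] at h3
  refine ⟨h2, ?_⟩
  simp only [smul_eq_mul] at h1
  rw [h3] at h1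
  linarith

/-- Quadratic growth at the minimizer of a proximally regularized weakly convex function. -/
lemma ConvexOn.prox_growth {K : Set E} {h : E → ℝ} {m r : ℝ}
    (hh : ConvexOn ℝ K fun y => h y + m / 2 * ‖y‖ ^ 2) {x p : E} (hp : p ∈ K)
    (hmin : ∀ y ∈ K, h p + r / 2 * ‖p - x‖ ^ 2 ≤ h y + r / 2 * ‖y - x‖ ^ 2) {y : E} (hy : y ∈ K) :
    h p + r / 2 * ‖p - x‖ ^ 2 + (r - m) / 2 * ‖y - p‖ ^ 2 ≤ h y + r / 2 * ‖y - x‖ ^ 2 := by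
  refine le_of_forall_mem_Ioo_le_add_mul (c := (r - m) / 2 * ‖y - p‖ ^ 2) fun t ht0 ht1 => ?_
  obtain ⟨hz, h1⟩ := hh.weak_lineMap_le hp hy ht0.le ht1.le
  have h2 := hmin _ hz
  rw [norm_lineMap_sub_sq] at h2
  refine le_of_mul_le_mul_left ?_ ht0
  linarith

/-- The local inequality holds at points of the segment near `x`; weak convexity bounds the value
there by the endpoint values, and division by `t` carries it to `y`. -/
lemma ConvexOn.le_of_mem_frechetSubdiff {h : E → ℝ} {m : ℝ}
    (hh : ConvexOn ℝ Set.univ fun y => h y + m / 2 * ‖y‖ ^ 2) {x g : E}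
    (hg : g ∈ frechetSubdiff h x) (y : E) :
    h x + inner ℝ g (y - x) - m / 2 * ‖y - x‖ ^ 2 ≤ h y := by
  refine le_of_forall_mem_Ioo_le_add_mul (c := ‖y - x‖ + |m| / 2 * ‖y - x‖ ^ 2)
    fun ε hε _ => ?_
  have hcont : Tendsto (fun t : ℝ => x + t • (y - x)) (𝓝[>] 0) (𝓝 x) := by
    have : Continuous fun t : ℝ => x + t • (y - x) := by fun_prop
    simpa using (this.tendsto 0).mono_left nhdsWithin_le_nhds
  have hev := hcont.eventually (hg ε hε)
  -- With `t < ε` the curvature error of order `t` is also of order `ε`, so one limit suffices.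
  obtain ⟨t, h1, ht0, ht1⟩ :=
    (hev.and (Ioo_mem_nhdsGT (lt_min hε (zero_lt_one' ℝ)))).exists
  have ht1' := (lt_min_iff.1 ht1).2
  have htε := (lt_min_iff.1 ht1).1
  obtain ⟨-, h2⟩ := hh.weak_lineMap_le (Set.mem_univ x) (Set.mem_univ y) ht0.le ht1'.le
  simp only [add_sub_cancel_left, inner_smul_right, norm_smul, Real.norm_eq_abs,
    abs_of_pos ht0] at h1
  have h3 : h x + inner ℝ g (y - x) - ε * ‖y - x‖ ≤ h y + m / 2 * ((1 - t) * ‖y - x‖ ^ 2) := by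
    refine le_of_mul_le_mul_left ?_ ht0
    linarith
  have h4 : -(m / 2 * (t * ‖y - x‖ ^ 2)) ≤ ε * (|m| / 2 * ‖y - x‖ ^ 2) := by
    have : -m * t ≤ |m| * ε :=
      mul_le_mul (neg_le_abs m) htε.le ht0.le (abs_nonneg m)
    nlinarith [mul_le_mul_of_nonneg_right this (sq_nonneg ‖y - x‖)]
  linarith

end Convex

/-! ### Growth of `f` in the two scenarios -/

section Smooth

variable {E : Type*} [NormedAddCommGroup E] [InnerProductSpace ℝ E] [CompleteSpace E]

lemma LipschitzWith.le_of_gradient {f : E → ℝ} {L : ℝ≥0} (hf : Differentiable ℝ f)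
    (hL : LipschitzWith L (gradient f)) (x y : E) :
    f y ≤ f x + inner ℝ (gradient f x) (y - x) + L / 2 * ‖y - x‖ ^ 2 := by
  set v := y - x with hv
  let q : ℝ → ℝ := fun t => f (x + t • v) - t * inner ℝ (gradient f x) v - L / 2 * ‖v‖ ^ 2 * t ^ 2
  have hline : ∀ t : ℝ, HasDerivAt (fun t : ℝ => x + t • v) v t := fun t => by
    simpa using ((hasDerivAt_id t).smul_const v).const_add x
  have hd : ∀ t : ℝ, HasDerivAt q
      (inner ℝ (gradient f (x + t • v)) v - inner ℝ (gradient f x) v - L * ‖v‖ ^ 2 * t) t := by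
    intro t
    have h1 : HasDerivAt (fun t : ℝ => f (x + t • v)) (inner ℝ (gradient f (x + t • v)) v) t := by
      have h := (hf (x + t • v)).hasGradientAt.hasFDerivAt.comp_hasDerivAt t (hline t)
      exact h
    have h2 : HasDerivAt (fun t : ℝ => t * inner ℝ (gradient f x) v)
        (inner ℝ (gradient f x) v) t := by
      simpa using (hasDerivAt_id t).mul_const (inner ℝ (gradient f x) v)
    have h3 : HasDerivAt (fun t : ℝ => (L : ℝ) / 2 * ‖v‖ ^ 2 * t ^ 2) (L * ‖v‖ ^ 2 * t) t := by
      refine ((hasDerivAt_pow 2 t).const_mul ((L : ℝ) / 2 * ‖v‖ ^ 2)).congr_deriv ?_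
      push_cast; ring
    exact (h1.sub h2).sub h3
  have hanti : AntitoneOn q (Set.Icc 0 1) := by
    refine antitoneOn_of_deriv_nonpos (convex_Icc 0 1)
      (fun t _ => (hd t).continuousAt.continuousWithinAt)
      (fun t _ => (hd t).differentiableAt.differentiableWithinAt) fun t ht => ?_
    rw [interior_Icc] at ht
    rw [(hd t).deriv, ← inner_sub_left]
    have h1 := real_inner_le_norm (gradient f (x + t • v) - gradient f x) v
    have h2 := hL.norm_sub_le (x + t • v) x
    rw [add_sub_cancel_left, norm_smul, Real.norm_eq_abs, abs_of_pos ht.1] at h2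
    have h3 := mul_le_mul_of_nonneg_right h2 (norm_nonneg v)
    linarith
  have h := hanti (by simp : (0 : ℝ) ∈ Set.Icc 0 1) (by simp : (1 : ℝ) ∈ Set.Icc 0 1) zero_le_one
  simp only [q, hv, one_smul, zero_smul, add_zero, one_mul, zero_mul, add_sub_cancel] at h
  linarith

/-- A gradient step cannot go below the lower bound. The step length `1 / (L + 1)` instead of `1 /
L` covers `L = 0`. -/
lemma LipschitzWith.norm_gradient_sq_le {f : E → ℝ} {L : ℝ≥0} (hf : Differentiable ℝ f)
    (hL : LipschitzWith L (gradient f)) {b : ℝ} (hb : ∀ x, b ≤ f x) (x : E) :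
    ‖gradient f x‖ ^ 2 ≤ 2 * (L + 1) * (f x - b) := by
  have hL0 : (0 : ℝ) ≤ L := L.2
  have hL1 : (0 : ℝ) < L + 1 := by linarith
  have h1 := hL.le_of_gradient hf x (x - (1 / ((L : ℝ) + 1)) • gradient f x)
  have h2 := hb (x - (1 / ((L : ℝ) + 1)) • gradient f x)
  rw [show x - (1 / ((L : ℝ) + 1)) • gradient f x - x = -((1 / ((L : ℝ) + 1)) • gradient f x) by
    abel, inner_neg_right, inner_smul_right, real_inner_self_eq_norm_sq, norm_neg, norm_smul,
    Real.norm_eq_abs, abs_of_pos (by positivity), mul_pow] at h1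
  have h3 : (L : ℝ) / 2 * ((1 / ((L : ℝ) + 1)) ^ 2 * ‖gradient f x‖ ^ 2)
      ≤ 1 / (L + 1) / 2 * ‖gradient f x‖ ^ 2 := by
    have : (L : ℝ) * (1 / ((L : ℝ) + 1)) ^ 2 ≤ 1 / (L + 1) := by
      rw [div_pow, one_pow, mul_one_div, div_le_div_iff₀ (by positivity) hL1]
      nlinarith
    nlinarith [sq_nonneg ‖gradient f x‖]
  have h4 : 1 / ((L : ℝ) + 1) / 2 * ‖gradient f x‖ ^ 2 ≤ f x - b := by linarith
  have h5 := mul_le_mul_of_nonneg_left h4 (by positivity : 0 ≤ 2 * ((L : ℝ) + 1))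
  calc ‖gradient f x‖ ^ 2 = 2 * (L + 1) * (1 / ((L : ℝ) + 1) / 2 * ‖gradient f x‖ ^ 2) := by
        field_simp
    _ ≤ _ := h5

/-- In both scenarios, `f` is continuous and bounded below on `dom φ`, and its gap to the lower
bound grows at most quadratically. -/
lemma exists_gap_le {f : E → ℝ} {φ : E → EReal} {b : ℝ} {Lf L : ℝ≥0}
    (hf : LipschitzScenario f φ b Lf ∨ SmoothScenario f b L) :
    (∀ x ∈ effDom φ, b ≤ f x) ∧ ContinuousOn f (effDom φ) ∧
      ∃ A B : ℝ, 0 ≤ A ∧ 0 ≤ B ∧ ∀ x ∈ effDom φ, ∀ y ∈ effDom φ,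
        f x - b ≤ A + B * (f y - b + ‖x - y‖ ^ 2) := by
  rcases hf with ⟨hb, hl⟩ | ⟨hb, hd, hl⟩
  · have hLf : (0 : ℝ) ≤ Lf := Lf.2
    refine ⟨hb, hl.continuousOn, Lf, Lf + 1, hLf, by linarith, fun x hx y hy => ?_⟩
    have h1 := hl.norm_sub_le hx hy
    have h2 := (le_abs_self _).trans h1
    have h3 : ‖x - y‖ ≤ 1 + ‖x - y‖ ^ 2 := by nlinarith [sq_nonneg (‖x - y‖ - 1)]
    have h4 := mul_le_mul_of_nonneg_left h3 hLf
    nlinarith [hb y hy, sq_nonneg ‖x - y‖]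
  · have hL0 : (0 : ℝ) ≤ L := L.2
    refine ⟨fun x _ => hb x, hd.continuous.continuousOn, 0, 2 * L + 2, le_rfl, by linarith,
      fun x _ y _ => ?_⟩
    -- The descent lemma based at `y`; Young's inequality splits the linear term, and the gradient
    -- is bounded by the gap at `y`.
    have h1 := hl.le_of_gradient hd y x
    have h2 := hl.norm_gradient_sq_le hd hb y
    have h3 := real_inner_le_norm (gradient f y) (x - y)
    nlinarith [sq_nonneg (‖gradient f y‖ - ‖x - y‖), sq_nonneg ‖x - y‖, hb y,
      mul_nonneg hL0 (sq_nonneg ‖x - y‖), mul_nonneg hL0 (sub_nonneg.2 (hb y))]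

end Smooth

/-! ### Proximal points and values of the envelope -/

section Prox

variable {E : Type*} [NormedAddCommGroup E]

/-- `P` maps every `x` to a minimizer over `K` of `h + ‖· - x‖² / (2 θ)`. -/
def IsProxMap (θ : ℝ) (h : E → ℝ) (K : Set E) (P : E → E) : Prop :=
  ∀ x, P x ∈ K ∧ ∀ y ∈ K, h (P x) + 1 / θ / 2 * ‖P x - x‖ ^ 2 ≤ h y + 1 / θ / 2 * ‖y - x‖ ^ 2

lemma exists_isProxMap [ProperSpace E] {θ b : ℝ} {h : E → ℝ} {K : Set E} (hθ : 0 < θ)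
    (hK : IsClosed K) (hne : K.Nonempty) (hc : ContinuousOn h K) (hb : ∀ y ∈ K, b ≤ h y) :
    ∃ P, IsProxMap θ h K P := by
  have key : ∀ x, ∃ p, p ∈ K ∧ ∀ y ∈ K,
      h p + 1 / θ / 2 * ‖p - x‖ ^ 2 ≤ h y + 1 / θ / 2 * ‖y - x‖ ^ 2 := by
    intro x
    obtain ⟨y₀, hy₀⟩ := hne
    have hcont : ContinuousOn (fun y => h y + 1 / θ / 2 * ‖y - x‖ ^ 2) K :=
      hc.add (by fun_prop)
    set v := h y₀ + 1 / θ / 2 * ‖y₀ - x‖ ^ 2 with hv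
    have hθ' : 0 < 1 / θ / 2 := by positivity
    -- Outside the ball of radius `R ≥ 1` the squared distance is at least `R`, so the quadratic
    -- alone exceeds `v - b`.
    set R := (v - b) / (1 / θ / 2) + 1 with hR
    have hvb : 0 ≤ v - b := by
      have := hb _ hy₀
      have : 0 ≤ 1 / θ / 2 * ‖y₀ - x‖ ^ 2 := by positivity
      linarith
    have hR1 : 1 ≤ R := by
      have : 0 ≤ (v - b) / (1 / θ / 2) := by positivity
      linarith
    have hco : ∀ᶠ y in cocompact E ⊓ 𝓟 K,
        h y₀ + 1 / θ / 2 * ‖y₀ - x‖ ^ 2 ≤ h y + 1 / θ / 2 * ‖y - x‖ ^ 2 := by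
      have h1 := (isCompact_closedBall x R).compl_mem_cocompact
      filter_upwards [mem_inf_of_left h1, mem_inf_of_right (mem_principal_self K)] with y hy hyK
      have hy' : R < ‖y - x‖ := by simpa [dist_eq_norm] using hy
      have h3 : R ≤ ‖y - x‖ ^ 2 := by nlinarith
      have h4 := mul_le_mul_of_nonneg_left h3 hθ'.le
      rw [hR, mul_add, mul_div_cancel₀ _ hθ'.ne'] at h4
      have := hb y hyK
      linarith
    obtain ⟨p, hp, hmin⟩ := hcont.exists_isMinOn' hK hy₀ hco
    exact ⟨p, hp, fun y hy => hmin hy⟩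
  choose P hP using key
  exact ⟨P, hP⟩

lemma IsProxMap.moreauEnv_eq {θ : ℝ} {ψ : E → EReal} {P : E → E} (hbot : ∀ y, ψ y ≠ ⊥)
    (hP : IsProxMap θ (fun y => (ψ y).toReal) (effDom ψ) P) (x : E) :
    moreauEnv θ ψ x = (ψ (P x)).toReal + 1 / θ / 2 * ‖P x - x‖ ^ 2 := by
  have hval : ∀ y ∈ effDom ψ, ψ y + ((1 / (2 * θ) * ‖x - y‖ ^ 2 : ℝ) : EReal)
      = (((ψ y).toReal + 1 / θ / 2 * ‖y - x‖ ^ 2 : ℝ) : EReal) := by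
    intro y hy
    rw [EReal.coe_add, EReal.coe_toReal (ne_of_lt hy) (hbot y), norm_sub_rev x y]
    congr 3
    rw [div_div, mul_comm]
  unfold moreauEnv
  have : (⨅ y : E, ψ y + ((1 / (2 * θ) * ‖x - y‖ ^ 2 : ℝ) : EReal))
      = (((ψ (P x)).toReal + 1 / θ / 2 * ‖P x - x‖ ^ 2 : ℝ) : EReal) := by
    refine le_antisymm ((iInf_le _ (P x)).trans_eq (hval _ (hP x).1)) (le_iInf fun y => ?_)
    by_cases hy : y ∈ effDom ψ
    · rw [hval y hy]
      exact EReal.coe_le_coe_iff.2 ((hP x).2 y hy)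
    · have : ψ y = ⊤ := by simpa [effDom] using hy
      rw [this, EReal.top_add_coe]
      exact le_top
  rw [this, EReal.toReal_coe]

lemma IsProxMap.norm_sub_sq_le {θ b : ℝ} {h : E → ℝ} {K : Set E} {P : E → E} (hθ : 0 < θ)
    (hP : IsProxMap θ h K P) (hb : ∀ y ∈ K, b ≤ h y) (x : E) :
    ‖P x - x‖ ^ 2 ≤ 2 * θ * (h (P x) + 1 / θ / 2 * ‖P x - x‖ ^ 2 - b) := by
  have h1 := hb _ (hP x).1
  have : 2 * θ * (h (P x) + 1 / θ / 2 * ‖P x - x‖ ^ 2 - b)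
      = 2 * θ * (h (P x) - b) + ‖P x - x‖ ^ 2 := by
    field_simp; ring
  rw [this]
  nlinarith [mul_nonneg hθ.le (sub_nonneg.2 h1)]

end Prox

/-! ### Lipschitz proximal map and gradient of the envelope -/

section ProxInner

variable {E : Type*} [NormedAddCommGroup E] [InnerProductSpace ℝ E]
  {θ m : ℝ} {h : E → ℝ} {K : Set E} {P : E → E}

lemma IsProxMap.growth (hP : IsProxMap θ h K P)
    (hh : ConvexOn ℝ K fun y => h y + m / 2 * ‖y‖ ^ 2) (x : E) {y : E} (hy : y ∈ K) :
    h (P x) + 1 / θ / 2 * ‖P x - x‖ ^ 2 + (1 / θ - m) / 2 * ‖y - P x‖ ^ 2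
      ≤ h y + 1 / θ / 2 * ‖y - x‖ ^ 2 :=
  hh.prox_growth (hP x).1 (hP x).2 hy

/-- Quadratic growth at each of the two proximal points, tested at the other: in the sum the values
of `h` cancel and the squares collapse to an inner product. -/
lemma IsProxMap.norm_sub_le (hP : IsProxMap θ h K P) (hθ : 0 < θ) (hm : θ * m < 1)
    (hh : ConvexOn ℝ K fun y => h y + m / 2 * ‖y‖ ^ 2) (x z : E) :
    ‖P x - P z‖ ≤ 1 / (1 - θ * m) * ‖x - z‖ := by
  have h1 := hP.growth hh x (hP z).1
  have h2 := hP.growth hh z (hP x).1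
  rw [norm_sub_rev (P z) (P x)] at h1
  have e : ‖P z - x‖ ^ 2 - ‖P x - x‖ ^ 2 + ‖P x - z‖ ^ 2 - ‖P z - z‖ ^ 2
      = 2 * inner ℝ (P x - P z) (x - z) := by
    simp only [norm_sub_sq_real, inner_sub_left, inner_sub_right]
    ring
  have h3 := real_inner_le_norm (P x - P z) (x - z)
  have h4 : (1 / θ - m) * ‖P x - P z‖ ^ 2 ≤ 1 / θ * (‖P x - P z‖ * ‖x - z‖) := by
    have := mul_le_mul_of_nonneg_left h3 (by positivity : 0 ≤ 1 / θ)
    have e' := congrArg (fun s => 1 / θ / 2 * s) e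
    linarith
  have h5 : (1 - θ * m) * ‖P x - P z‖ ^ 2 ≤ ‖P x - P z‖ * ‖x - z‖ := by
    have := mul_le_mul_of_nonneg_left h4 hθ.le
    have e1 : θ * ((1 / θ - m) * ‖P x - P z‖ ^ 2) = (1 - θ * m) * ‖P x - P z‖ ^ 2 := by
      field_simp
    have e2 : θ * (1 / θ * (‖P x - P z‖ * ‖x - z‖)) = ‖P x - P z‖ * ‖x - z‖ := by
      field_simp
    rwa [e1, e2] at this
  have hpos : 0 < 1 - θ * m := by linarith
  rw [one_div_mul_eq_div, le_div_iff₀ hpos]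
  rcases (norm_nonneg (P x - P z)).eq_or_lt with h0 | h0
  · rw [← h0, zero_mul]; exact norm_nonneg _
  · refine le_of_mul_le_mul_left ?_ h0
    linarith

lemma IsProxMap.env_le (hP : IsProxMap θ h K P) (x z : E) :
    h (P z) + 1 / θ / 2 * ‖P z - z‖ ^ 2 ≤ h (P x) + 1 / θ / 2 * ‖P x - x‖ ^ 2
      + 1 / θ * inner ℝ (x - P x) (z - x) + 1 / θ / 2 * ‖z - x‖ ^ 2 := by
  have h1 := (hP z).2 _ (hP x).1
  have e : ‖P x - z‖ ^ 2 = ‖P x - x‖ ^ 2 + 2 * inner ℝ (x - P x) (z - x) + ‖z - x‖ ^ 2 := by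
    have : P x - z = -((x - P x) + (z - x)) := by abel
    rw [this, norm_neg, norm_add_sq_real, norm_sub_rev x (P x)]
  rw [e] at h1
  linarith

/-- `IsProxMap.env_le` gives the upper expansion; with the points exchanged it gives the lower one,
up to the change of `P`, which is Lipschitz. The remainder is thus quadratic. -/
lemma IsProxMap.hasGradientAt_env [CompleteSpace E] (hP : IsProxMap θ h K P) (hθ : 0 < θ)
    (hm : θ * m < 1) (hh : ConvexOn ℝ K fun y => h y + m / 2 * ‖y‖ ^ 2) (x : E) :
    HasGradientAt (fun z => h (P z) + 1 / θ / 2 * ‖P z - z‖ ^ 2) ((1 / θ) • (x - P x)) x := by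
  have hpos : 0 < 1 - θ * m := by linarith
  set c := 1 / θ * (2 + 1 / (1 - θ * m)) with hc
  have hbound : ∀ z, |(h (P z) + 1 / θ / 2 * ‖P z - z‖ ^ 2)
      - (h (P x) + 1 / θ / 2 * ‖P x - x‖ ^ 2) - inner ℝ ((1 / θ) • (x - P x)) (z - x)|
      ≤ c * ‖z - x‖ ^ 2 := by
    intro z
    have hθ' : 0 < 1 / θ := by positivity
    have h1 := hP.env_le x z
    have h2 := hP.env_le z x
    rw [norm_sub_rev x z] at h2
    have h3 := hP.norm_sub_le hθ hm hh x z
    have e : inner ℝ (z - P z) (x - z)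
        = -inner ℝ (x - P x) (z - x) - ‖z - x‖ ^ 2 - inner ℝ (P x - P z) (z - x) := by
      have e1 : z - P z = (x - P x) + (z - x) + (P x - P z) := by abel
      have e2 : x - z = -(z - x) := by abel
      rw [e2, inner_neg_right, e1, inner_add_left, inner_add_left, real_inner_self_eq_norm_sq]
      ring
    have h4 : |inner ℝ (P x - P z) (z - x)| ≤ 1 / (1 - θ * m) * ‖z - x‖ ^ 2 := by
      refine (abs_real_inner_le_norm _ _).trans ?_
      rw [norm_sub_rev x z] at h3
      calc _ ≤ 1 / (1 - θ * m) * ‖z - x‖ * ‖z - x‖ :=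
            mul_le_mul_of_nonneg_right h3 (norm_nonneg _)
        _ = _ := by ring
    have h5 := abs_le.1 h4
    rw [e] at h2
    rw [inner_smul_left]
    simp only [conj_trivial]
    have h6 := mul_le_mul_of_nonneg_left h5.1 hθ'.le
    have h7 := mul_le_mul_of_nonneg_left h5.2 hθ'.le
    have h8 : 0 ≤ 1 / θ * ‖z - x‖ ^ 2 := by positivity
    have h9 : 0 ≤ 1 / θ * (1 / (1 - θ * m) * ‖z - x‖ ^ 2) := by positivity
    rw [abs_le]
    constructor <;> rw [hc] <;> linarith
  rw [hasGradientAt_iff_hasFDerivAt, hasFDerivAt_iff_isLittleO]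
  have hO : (fun z => (h (P z) + 1 / θ / 2 * ‖P z - z‖ ^ 2)
      - (h (P x) + 1 / θ / 2 * ‖P x - x‖ ^ 2) - inner ℝ ((1 / θ) • (x - P x)) (z - x))
      =O[𝓝 x] fun z => ‖z - x‖ ^ 2 := by
    refine Asymptotics.IsBigO.of_bound c (Eventually.of_forall fun z => ?_)
    rw [Real.norm_eq_abs, Real.norm_eq_abs, abs_of_nonneg (sq_nonneg ‖z - x‖)]
    exact hbound z
  have ho : (fun z => ‖z - x‖ ^ 2) =o[𝓝 x] fun z => z - x :=
    Asymptotics.isLittleO_pow_sub_sub x one_lt_two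
  exact hO.trans_isLittleO ho

end ProxInner

/-! ### A deterministic convergence criterion -/

/-- The cube is the right power: the leading increment of `a ^ 3` is `3 a² δ`, which is summable, so
`a ^ 3` is Cauchy and `a` converges. A positive limit would make `∑ α` finite. -/
lemma tendsto_zero_of_summable_mul_sq {α d a : ℕ → ℝ} {M : ℝ} (hα : ∀ k, 0 ≤ α k)
    (hα_sum : Tendsto (fun N => ∑ k ∈ Finset.range N, α k) atTop atTop)
    (ha : ∀ k, 0 ≤ a k) (haM : ∀ k, a k ≤ M)
    (hstep : ∀ k, |a (k + 1) - a k| ≤ d k) (h1 : Summable fun k => d k ^ 2)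
    (h2 : Summable fun k => d k * a k ^ 2) (h3 : Summable fun k => α k * a k ^ 2) :
    Tendsto a atTop (𝓝 0) := by
  have hcauchy : CauchySeq fun k => a k ^ 3 := by
    refine cauchySeq_of_dist_le_of_summable (fun k => 3 * (d k * a k ^ 2) + 4 * M * d k ^ 2)
      (fun k => ?_) ((h2.mul_left 3).add (h1.mul_left (4 * M)))
    rw [dist_comm, Real.dist_eq]
    set δ := a (k + 1) - a k with hδ
    have e : a (k + 1) ^ 3 - a k ^ 3 = 3 * a k ^ 2 * δ + 3 * a k * δ ^ 2 + δ * δ ^ 2 := by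
      rw [hδ]; ring
    have hδM : |δ| ≤ M := by
      rw [abs_le]
      constructor <;> linarith [ha k, ha (k + 1), haM k, haM (k + 1)]
    have hδ2 : δ ^ 2 ≤ d k ^ 2 := sq_le_sq' (abs_le.1 (hstep k)).1 (abs_le.1 (hstep k)).2
    have hM : 0 ≤ M := (ha k).trans (haM k)
    have t1 : |3 * a k ^ 2 * δ| ≤ 3 * (d k * a k ^ 2) := by
      rw [abs_mul, abs_of_nonneg (by positivity)]
      nlinarith [mul_le_mul_of_nonneg_left (hstep k) (sq_nonneg (a k))]
    have t2 : |3 * a k * δ ^ 2| ≤ 3 * M * d k ^ 2 := by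
      rw [abs_of_nonneg (mul_nonneg (mul_nonneg (by norm_num) (ha k)) (sq_nonneg δ))]
      exact mul_le_mul (by linarith [haM k]) hδ2 (sq_nonneg _) (by positivity)
    have t3 : |δ * δ ^ 2| ≤ M * d k ^ 2 := by
      rw [abs_mul, abs_of_nonneg (sq_nonneg δ)]
      exact mul_le_mul hδM hδ2 (sq_nonneg _) hM
    rw [e]
    linarith [abs_add_le (3 * a k ^ 2 * δ + 3 * a k * δ ^ 2) (δ * δ ^ 2),
      abs_add_le (3 * a k ^ 2 * δ) (3 * a k * δ ^ 2)]
  obtain ⟨l, hl⟩ := cauchySeq_tendsto_of_complete hcauchy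
  have hlim : Tendsto a atTop (𝓝 (l ^ ((3 : ℕ) : ℝ)⁻¹)) := by
    refine (hl.rpow_const (Or.inr (by positivity))).congr fun k => ?_
    exact Real.pow_rpow_inv_natCast (ha k) (by norm_num)
  set r := l ^ ((3 : ℕ) : ℝ)⁻¹
  have hr : 0 ≤ r := ge_of_tendsto' hlim ha
  rcases hr.eq_or_lt with h0 | h0
  · rwa [← h0] at hlim
  · exfalso
    refine (not_summable_iff_tendsto_nat_atTop_of_nonneg hα).2 hα_sum ?_
    refine (h3.mul_left ((r / 2) ^ 2)⁻¹).of_norm_bounded_eventually_nat ?_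
    filter_upwards [hlim.eventually (lt_mem_nhds (half_lt_self h0))] with k hk
    rw [Real.norm_eq_abs, abs_of_nonneg (hα k), inv_mul_eq_div, le_div_iff₀ (by positivity)]
    exact mul_le_mul_of_nonneg_left (pow_le_pow_left₀ (by positivity) hk.le 2) (hα k)

/-! ### Almost supermartingales and stochastic descent -/

section Probability

variable {Ω : Type*} [mΩ : MeasurableSpace Ω] {μ : Measure Ω}

lemma ae_summable_of_summable_integral {X : ℕ → Ω → ℝ} (hX : ∀ k, 0 ≤ᵐ[μ] X k)
    (hint : ∀ k, Integrable (X k) μ) (hs : Summable fun k => ∫ ω, X k ω ∂μ) :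
    ∀ᵐ ω ∂μ, Summable fun k => X k ω := by
  have h1 : ∫⁻ ω, ∑' k, ENNReal.ofReal (X k ω) ∂μ ≠ ⊤ := by
    rw [lintegral_tsum fun k => (hint k).aemeasurable.ennreal_ofReal]
    simp_rw [← fun k => ofReal_integral_eq_lintegral_ofReal (hint k) (hX k)]
    exact hs.tsum_ofReal_ne_top
  have h2 := ae_lt_top' (AEMeasurable.tsum fun k =>
    (hint k).aemeasurable.ennreal_ofReal) h1
  filter_upwards [h2, ae_all_iff.2 hX] with ω hω hω0
  refine (ENNReal.summable_toReal hω.ne).congr fun k => ?_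
  exact ENNReal.toReal_ofReal (hω0 k)

lemma sq_integral_le_integral_sq [IsProbabilityMeasure μ] {X : Ω → ℝ} (hX : MemLp X 2 μ) :
    (∫ ω, X ω ∂μ) ^ 2 ≤ ∫ ω, X ω ^ 2 ∂μ := by
  have h := ProbabilityTheory.variance_nonneg X μ
  rw [ProbabilityTheory.variance_eq_sub hX] at h
  simp only [Pi.pow_apply] at h
  linarith

variable [IsProbabilityMeasure μ] {ℱ : Filtration ℕ mΩ}

/-- A nonnegative almost supermartingale is almost surely bounded and bounded in expectation, and
its expected decrease is summable. -/
lemma almost_supermartingale_bounds {e b : ℕ → Ω → ℝ} {β : ℕ → ℝ} (hβ : ∀ k, 0 ≤ β k)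
    (hβs : Summable β) (he : ∀ k ω, 0 ≤ e k ω) (hem : ∀ k, StronglyMeasurable[ℱ k] (e k))
    (hei : ∀ k, Integrable (e k) μ) (hb : ∀ k ω, 0 ≤ b k ω)
    (hdesc : ∀ k A, MeasurableSet[ℱ k] A →
      ∫ ω in A, e (k + 1) ω ∂μ ≤ (1 + β k) * ∫ ω in A, e k ω ∂μ - ∫ ω in A, b k ω ∂μ) :
    (∃ R, ∀ k, ∫ ω, e k ω ∂μ ≤ R) ∧ (∀ᵐ ω ∂μ, ∃ R, ∀ k, e k ω ≤ R) ∧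
      Summable fun k => ∫ ω, b k ω ∂μ := by
  -- Division by this product absorbs the factors `1 + β` and leaves a true supermartingale. As it
  -- stays below `exp (∑ β)`, bounds transfer back.
  set Q : ℕ → ℝ := fun k => ∏ i ∈ Finset.range k, (1 + β i) with hQ
  have hQpos : ∀ k, 0 < Q k := fun k => Finset.prod_pos fun i _ => by linarith [hβ i]
  have hQs : ∀ k, Q (k + 1) = Q k * (1 + β k) := fun k => Finset.prod_range_succ _ _
  set B := Real.exp (∑' i, β i) with hB
  have hQB : ∀ k, Q k ≤ B := by
    intro k
    calc Q k ≤ ∏ i ∈ Finset.range k, Real.exp (β i) :=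
          Finset.prod_le_prod (fun i _ => by linarith [hβ i]) fun i _ => by
            linarith [Real.add_one_le_exp (β i)]
      _ = Real.exp (∑ i ∈ Finset.range k, β i) := (Real.exp_sum _ _).symm
      _ ≤ B := Real.exp_le_exp.2 (hβs.sum_le_tsum _ fun i _ => hβ i)
  have hBpos : 0 < B := Real.exp_pos _
  set M : ℕ → Ω → ℝ := fun k ω => (Q k)⁻¹ * e k ω with hM
  have hMi : ∀ k, Integrable (M k) μ := fun k => (hei k).const_mul _
  have hMdesc : ∀ k A, MeasurableSet[ℱ k] A → ∫ ω in A, M (k + 1) ω ∂μ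
      ≤ ∫ ω in A, M k ω ∂μ - (Q (k + 1))⁻¹ * ∫ ω in A, b k ω ∂μ := by
    intro k A hA
    have h := mul_le_mul_of_nonneg_left (hdesc k A hA) (inv_pos.2 (hQpos (k + 1))).le
    simp only [hM]
    rw [integral_const_mul, integral_const_mul]
    refine h.trans_eq ?_
    rw [mul_sub, hQs]
    have := (hQpos k).ne'
    have : 1 + β k ≠ 0 := by linarith [hβ k]
    field_simp
  have hMsuper : Supermartingale M ℱ μ := by
    refine supermartingale_of_setIntegral_succ_le (fun k => (hem k).const_mul _) hMi
      fun k A hA => (hMdesc k A hA).trans ?_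
    have : 0 ≤ (Q (k + 1))⁻¹ * ∫ ω in A, b k ω ∂μ :=
      mul_nonneg (inv_pos.2 (hQpos _)).le (integral_nonneg fun ω => hb k ω)
    linarith
  have hMstep : ∀ k, (Q (k + 1))⁻¹ * ∫ ω, b k ω ∂μ ≤ ∫ ω, M k ω ∂μ - ∫ ω, M (k + 1) ω ∂μ := by
    intro k
    have := hMdesc k Set.univ MeasurableSet.univ
    simp only [setIntegral_univ] at this
    linarith
  have hb0 : ∀ k, 0 ≤ ∫ ω, b k ω ∂μ := fun k => integral_nonneg (hb k)
  have hM0 : ∀ k ω, 0 ≤ M k ω := fun k ω => mul_nonneg (inv_pos.2 (hQpos k)).le (he k ω)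
  have hsum : ∀ n, ∑ k ∈ Finset.range n, (Q (k + 1))⁻¹ * ∫ ω, b k ω ∂μ
      ≤ ∫ ω, M 0 ω ∂μ - ∫ ω, M n ω ∂μ := fun n => by
    rw [← Finset.sum_range_sub' (fun k => ∫ ω, M k ω ∂μ)]
    exact Finset.sum_le_sum fun k _ => hMstep k
  have hterm0 : ∀ k, 0 ≤ (Q (k + 1))⁻¹ * ∫ ω, b k ω ∂μ := fun k =>
    mul_nonneg (inv_pos.2 (hQpos _)).le (hb0 k)
  have hMle : ∀ n, ∫ ω, M n ω ∂μ ≤ ∫ ω, M 0 ω ∂μ := fun n => by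
    have := hsum n
    have := Finset.sum_nonneg fun k (_ : k ∈ Finset.range n) => hterm0 k
    linarith
  have heM : ∀ k ω, e k ω = Q k * M k ω := fun k ω => by
    simp only [hM]; rw [mul_inv_cancel_left₀ (hQpos k).ne']
  refine ⟨⟨B * ∫ ω, M 0 ω ∂μ, fun k => ?_⟩, ?_, ?_⟩
  · simp_rw [heM k]
    rw [integral_const_mul]
    exact mul_le_mul (hQB k) (hMle k) (integral_nonneg (hM0 k)) hBpos.le
  · have hbdd : ∀ k, eLpNorm ((-M) k) 1 μ ≤ ((∫ ω, M 0 ω ∂μ).toNNReal : ℝ≥0) := by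
      intro k
      rw [Pi.neg_apply, eLpNorm_neg, eLpNorm_one_eq_lintegral_enorm,
        ← ofReal_integral_norm_eq_lintegral_enorm (hMi k)]
      refine ENNReal.ofReal_le_ofReal ?_
      simp_rw [Real.norm_eq_abs, abs_of_nonneg (hM0 k _)]
      exact hMle k
    filter_upwards [hMsuper.neg.exists_ae_tendsto_of_bdd hbdd] with ω ⟨l, hl⟩
    obtain ⟨R, hR⟩ := hl.bddBelow_range
    refine ⟨B * (-R), fun k => ?_⟩
    have h1 : M k ω ≤ -R := by
      have := hR ⟨k, rfl⟩
      simp only [Pi.neg_apply] at this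
      linarith
    rw [heM]
    exact mul_le_mul (hQB k) h1 (hM0 k ω) hBpos.le
  · have h1 : Summable fun k => (Q (k + 1))⁻¹ * ∫ ω, b k ω ∂μ :=
      summable_of_sum_range_le hterm0 fun n => (hsum n).trans <|
        sub_le_self _ (integral_nonneg (hM0 n))
    refine Summable.of_nonneg_of_le hb0 (fun k => ?_) (h1.mul_left B)
    rw [← mul_assoc]
    refine le_mul_of_one_le_left (hb0 k) ?_
    rw [← div_eq_mul_inv, one_le_div (hQpos _)]
    exact hQB _

/-- Convergence of the stationarity measures `Γ k` of a stochastic method with merit values `e k`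
and random step lengths controlled by `W k`. -/
theorem tendsto_zero_of_descent {E : Type*} [NormedAddCommGroup E] {Γ : ℕ → Ω → E}
    {e W : ℕ → Ω → ℝ} {α : ℕ → ℝ} {c κ : ℝ} (hc : 0 ≤ c) (hκ : 0 < κ) (hα : ∀ k, 0 < α k)
    (hα_sum : Tendsto (fun N => ∑ k ∈ Finset.range N, α k) atTop atTop)
    (hα_sq : Summable fun k => α k ^ 2)
    (he : ∀ k ω, 1 ≤ e k ω) (hem : ∀ k, StronglyMeasurable[ℱ k] (e k))
    (hei : ∀ k, Integrable (e k) μ) (hΓm : ∀ k, StronglyMeasurable[ℱ k] (Γ k))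
    (hΓe : ∀ k ω, ‖Γ k ω‖ ^ 2 ≤ c * e k ω) (hW0 : ∀ k ω, 0 ≤ W k ω)
    (hW : ∀ k, MemLp (W k) 2 μ) (hWc : ∀ k, μ[fun ω => W k ω ^ 2 | ℱ k] ≤ᵐ[μ] fun ω => c * e k ω)
    (hstep : ∀ k, ∀ᵐ ω ∂μ, ‖Γ (k + 1) ω - Γ k ω‖ ≤ c * α k * (W k ω + 1))
    (hdesc : ∀ k A, MeasurableSet[ℱ k] A → ∫ ω in A, e (k + 1) ω ∂μ
      ≤ (1 + c * α k ^ 2) * ∫ ω in A, e k ω ∂μ - κ * α k * ∫ ω in A, ‖Γ k ω‖ ^ 2 ∂μ) :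
    Tendsto (fun k => ∫ ω, ‖Γ k ω‖ ∂μ) atTop (𝓝 0) ∧
      ∀ᵐ ω ∂μ, Tendsto (fun k => ‖Γ k ω‖) atTop (𝓝 0) := by
  obtain ⟨⟨R, hR⟩, hbdd, hsumb⟩ := almost_supermartingale_bounds (ℱ := ℱ) (μ := μ) (e := e)
    (b := fun k ω => κ * α k * ‖Γ k ω‖ ^ 2) (β := fun k => c * α k ^ 2)
    (fun k => by positivity) (hα_sq.mul_left c) (fun k ω => by linarith [he k ω]) hem hei
    (fun k ω => mul_nonneg (mul_pos hκ (hα k)).le (sq_nonneg _)) (fun k A hA => by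
      rw [integral_const_mul]; exact hdesc k A hA)
  have hΓm' : ∀ k, AEStronglyMeasurable (Γ k) μ := fun k =>
    ((hΓm k).mono (ℱ.le k)).aestronglyMeasurable
  have hΓ2 : ∀ k, Integrable (fun ω => ‖Γ k ω‖ ^ 2) μ := fun k =>
    ((hei k).const_mul c).mono' ((hΓm' k).norm.pow 2) (Eventually.of_forall fun ω => by
      rw [Real.norm_eq_abs, abs_of_nonneg (sq_nonneg _)]; exact hΓe k ω)
  have hΓL : ∀ k, MemLp (fun ω => ‖Γ k ω‖) 2 μ := fun k =>
    (memLp_two_iff_integrable_sq (hΓm' k).norm).2 (hΓ2 k)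
  have hΓi : ∀ k, Integrable (fun ω => ‖Γ k ω‖) μ := fun k => (hΓL k).integrable (by norm_num)
  have hΓint : ∀ k, Integrable (Γ k) μ := fun k => (integrable_norm_iff (hΓm' k)).1 (hΓi k)
  have hWi : ∀ k, Integrable (W k) μ := fun k => (hW k).integrable (by norm_num)
  have hW2 : ∀ k, ∫ ω, W k ω ^ 2 ∂μ ≤ c * R := by
    intro k
    rw [← integral_condExp (ℱ.le k)]
    refine (integral_mono_ae integrable_condExp ((hei k).const_mul c) (hWc k)).trans ?_
    rw [integral_const_mul]
    exact mul_le_mul_of_nonneg_left (hR k) hc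
  have hαΓ : Summable fun k => α k * ∫ ω, ‖Γ k ω‖ ^ 2 ∂μ := by
    refine (hsumb.mul_left κ⁻¹).congr fun k => ?_
    rw [integral_const_mul]
    field_simp
  constructor
  · have hW1 : ∀ k, ∫ ω, (W k ω + 1) ∂μ ≤ c * R + 2 := by
      intro k
      have h : ∫ ω, (W k ω + 1) ∂μ ≤ ∫ ω, (W k ω ^ 2 + 2) ∂μ := by
        refine integral_mono ((hWi k).add (integrable_const _))
          ((hW k).integrable_sq.add (integrable_const _)) fun ω => ?_
        nlinarith [sq_nonneg (W k ω - 1)]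
      rw [integral_add (hW k).integrable_sq (integrable_const _)] at h
      simp only [integral_const, probReal_univ, smul_eq_mul, one_mul] at h
      linarith [hW2 k]
    have hcR : 0 ≤ c * R := (integral_nonneg fun ω => sq_nonneg (W 0 ω)).trans (hW2 0)
    have hc' : 0 ≤ c * (c * R + 2) := by positivity
    have hsq : ∀ k, (∫ ω, ‖Γ k ω‖ ∂μ) ^ 2 ≤ ∫ ω, ‖Γ k ω‖ ^ 2 ∂μ := fun k =>
      sq_integral_le_integral_sq (hΓL k)
    have hs2 : Summable fun k => α k * (∫ ω, ‖Γ k ω‖ ∂μ) ^ 2 :=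
      Summable.of_nonneg_of_le (fun k => mul_nonneg (hα k).le (sq_nonneg _))
        (fun k => mul_le_mul_of_nonneg_left (hsq k) (hα k).le) hαΓ
    -- In the mean the increments are of order `α`, so both series with `d` reduce to known ones.
    -- The bound `M` comes from `a ≤ 1 + a²`.
    refine tendsto_zero_of_summable_mul_sq (α := α) (d := fun k => c * (c * R + 2) * α k)
      (M := 1 + c * R) (fun k => (hα k).le) hα_sum (fun k => integral_nonneg fun ω => norm_nonneg _)
      (fun k => ?_) (fun k => ?_) ?_ ?_ hs2
    · have h1 : ∫ ω, ‖Γ k ω‖ ^ 2 ∂μ ≤ c * R := by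
        refine (integral_mono (hΓ2 k) ((hei k).const_mul c) (hΓe k)).trans ?_
        rw [integral_const_mul]
        exact mul_le_mul_of_nonneg_left (hR k) hc
      nlinarith [hsq k, sq_nonneg (∫ ω, ‖Γ k ω‖ ∂μ - 1)]
    · rw [← integral_sub (hΓi _) (hΓi _)]
      calc |∫ ω, (‖Γ (k + 1) ω‖ - ‖Γ k ω‖) ∂μ|
          ≤ ∫ ω, |‖Γ (k + 1) ω‖ - ‖Γ k ω‖| ∂μ := abs_integral_le_integral_abs
        _ ≤ ∫ ω, c * α k * (W k ω + 1) ∂μ := by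
            refine integral_mono_ae ((hΓi _).sub (hΓi _)).abs
              (((hWi k).add (integrable_const _)).const_mul _) ?_
            filter_upwards [hstep k] with ω hω
            exact (abs_norm_sub_norm_le _ _).trans hω
        _ = c * α k * ∫ ω, (W k ω + 1) ∂μ := integral_const_mul _ _
        _ ≤ c * α k * (c * R + 2) :=
            mul_le_mul_of_nonneg_left (hW1 k) (mul_nonneg hc (hα k).le)
        _ = _ := by ring
    · simp_rw [mul_pow]
      exact hα_sq.mul_left _
    · simp_rw [mul_assoc _ (α _)]
      exact hs2.mul_left _
  -- The weight `‖Γ‖² / e` is bounded and known at time `k`, so it can be pulled out of the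
  -- conditional expectation of `W²`; the bound `c e` then cancels the denominator.
  · have hZm : ∀ k, StronglyMeasurable[ℱ k] fun ω => ‖Γ k ω‖ ^ 2 / e k ω := fun k =>
      (((hΓm k).norm.pow 2).measurable.div (hem k).measurable).stronglyMeasurable
    have hZ0 : ∀ k ω, 0 ≤ ‖Γ k ω‖ ^ 2 / e k ω := fun k ω =>
      div_nonneg (sq_nonneg _) (by linarith [he k ω])
    have hZc : ∀ k ω, ‖Γ k ω‖ ^ 2 / e k ω ≤ c := fun k ω => by
      rw [div_le_iff₀ (by linarith [he k ω])]; exact hΓe k ω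
    have hZn : ∀ k, ∀ᵐ ω ∂μ, ‖‖Γ k ω‖ ^ 2 / e k ω‖ ≤ c := fun k =>
      Eventually.of_forall fun ω => by
        rw [Real.norm_eq_abs, abs_of_nonneg (hZ0 k ω)]; exact hZc k ω
    have hZWi : ∀ k, Integrable (fun ω => ‖Γ k ω‖ ^ 2 / e k ω * W k ω ^ 2) μ := fun k =>
      (hW k).integrable_sq.bdd_mul ((hZm k).mono (ℱ.le k)).aestronglyMeasurable (hZn k)
    have hZW : ∀ k, ∫ ω, ‖Γ k ω‖ ^ 2 / e k ω * W k ω ^ 2 ∂μ ≤ c * ∫ ω, ‖Γ k ω‖ ^ 2 ∂μ := by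
      intro k
      have h1 := condExp_stronglyMeasurable_mul_of_bound (ℱ.le k) (hZm k)
        (hW k).integrable_sq c (hZn k)
      rw [← integral_const_mul, ← integral_condExp (ℱ.le k)]
      refine integral_mono_ae integrable_condExp ((hΓ2 k).const_mul c) ?_
      filter_upwards [h1, hWc k] with ω h1 h2
      refine (h1.trans_le ?_ : _)
      simp only [Pi.mul_apply]
      refine (mul_le_mul_of_nonneg_left h2 (hZ0 k ω)).trans_eq ?_
      have : e k ω ≠ 0 := by linarith [he k ω]
      field_simp
    have hs1 : ∀ᵐ ω ∂μ, Summable fun k => α k * ‖Γ k ω‖ ^ 2 := by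
      refine ae_summable_of_summable_integral (fun k => Eventually.of_forall fun ω =>
        mul_nonneg (hα k).le (sq_nonneg _)) (fun k => (hΓ2 k).const_mul _) ?_
      simpa only [integral_const_mul] using hαΓ
    have hs2 : ∀ᵐ ω ∂μ, Summable fun k => α k * (‖Γ k ω‖ ^ 2 / e k ω * W k ω ^ 2) := by
      refine ae_summable_of_summable_integral (fun k => Eventually.of_forall fun ω =>
        mul_nonneg (hα k).le (mul_nonneg (hZ0 k ω) (sq_nonneg _)))
        (fun k => (hZWi k).const_mul _) ?_
      simp only [integral_const_mul]
      refine Summable.of_nonneg_of_le (fun k => mul_nonneg (hα k).le (integral_nonneg fun ω =>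
        mul_nonneg (hZ0 k ω) (sq_nonneg _))) (fun k => ?_) (hαΓ.mul_left c)
      exact (mul_le_mul_of_nonneg_left (hZW k) (hα k).le).trans_eq (by ring)
    have hs3 : ∀ᵐ ω ∂μ, Summable fun k => α k ^ 2 * (W k ω ^ 2 + 1) := by
      refine ae_summable_of_summable_integral (fun k => Eventually.of_forall fun ω =>
        mul_nonneg (sq_nonneg _) (by positivity))
        (fun k => ((hW k).integrable_sq.add (integrable_const _)).const_mul _) ?_
      simp only [integral_const_mul]
      refine Summable.of_nonneg_of_le (fun k => mul_nonneg (sq_nonneg _) (integral_nonneg fun ω =>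
        by positivity)) (fun k => mul_le_mul_of_nonneg_left ?_ (sq_nonneg (α k)))
        (hα_sq.mul_right (c * R + 1))
      rw [integral_add (hW k).integrable_sq (integrable_const _)]
      simp only [integral_const, probReal_univ, smul_eq_mul, one_mul]
      linarith [hW2 k]
    filter_upwards [hs1, hs2, hs3, hbdd, ae_all_iff.2 hstep] with ω h1 h2 h3 ⟨S, hS⟩ h4
    have hcα : ∀ k, 0 ≤ c * α k := fun k => mul_nonneg hc (hα k).le
    have hd0 : ∀ k, 0 ≤ c * α k * (W k ω + 1) := fun k =>
      mul_nonneg (hcα k) (by linarith [hW0 k ω])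
    refine tendsto_zero_of_summable_mul_sq (α := α) (d := fun k => c * α k * (W k ω + 1))
      (M := 1 + c * S) (fun k => (hα k).le) hα_sum (fun k => norm_nonneg _)
      (fun k => ?_) (fun k => (abs_norm_sub_norm_le _ _).trans (h4 k)) ?_ ?_ h1
    · have := (hΓe k ω).trans (mul_le_mul_of_nonneg_left (hS k) hc)
      nlinarith [sq_nonneg (‖Γ k ω‖ - 1)]
    · refine Summable.of_nonneg_of_le (fun k => sq_nonneg _) (fun k => ?_)
        (h3.mul_left (2 * c ^ 2))
      have : (W k ω + 1) ^ 2 ≤ 2 * (W k ω ^ 2 + 1) := by nlinarith [sq_nonneg (W k ω - 1)]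
      calc (c * α k * (W k ω + 1)) ^ 2 = (c * α k) ^ 2 * (W k ω + 1) ^ 2 := by ring
        _ ≤ (c * α k) ^ 2 * (2 * (W k ω ^ 2 + 1)) :=
            mul_le_mul_of_nonneg_left this (sq_nonneg _)
        _ = _ := by ring
    · refine Summable.of_nonneg_of_le (fun k => mul_nonneg (hd0 k) (sq_nonneg _)) (fun k => ?_)
        ((h2.mul_left (c * S)).add (h1.mul_left (c * 2)))
      -- The pathwise bound `S` on `e` removes the weight again, so `∑ α W² ‖Γ‖²` converges along
      -- the path.
      have t1 : W k ω + 1 ≤ W k ω ^ 2 + 2 := by nlinarith [sq_nonneg (W k ω - 1)]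
      have t2 : ‖Γ k ω‖ ^ 2 ≤ ‖Γ k ω‖ ^ 2 / e k ω * S := by
        have : e k ω ≠ 0 := by linarith [he k ω]
        calc ‖Γ k ω‖ ^ 2 = ‖Γ k ω‖ ^ 2 / e k ω * e k ω := by field_simp
          _ ≤ _ := mul_le_mul_of_nonneg_left (hS k) (hZ0 k ω)
      calc c * α k * (W k ω + 1) * ‖Γ k ω‖ ^ 2
          ≤ c * α k * (W k ω ^ 2 + 2) * ‖Γ k ω‖ ^ 2 := by gcongr; exact hcα k
        _ = c * α k * W k ω ^ 2 * ‖Γ k ω‖ ^ 2 + c * 2 * (α k * ‖Γ k ω‖ ^ 2) := by ring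
        _ ≤ c * α k * W k ω ^ 2 * (‖Γ k ω‖ ^ 2 / e k ω * S) + c * 2 * (α k * ‖Γ k ω‖ ^ 2) := by
            gcongr; exact mul_nonneg (hcα k) (sq_nonneg _)
        _ = _ := by ring

end Probability

/-! ### From deterministic points to measurable selections -/

section Fatou

variable {Ω : Type*} {m : MeasurableSpace Ω} [mΩ : MeasurableSpace Ω] {μ : Measure Ω}

lemma integrable_and_integral_le_of_tendsto {F : ℕ → Ω → ℝ} {G : Ω → ℝ} {c : ℝ}
    (hF0 : ∀ j, 0 ≤ᵐ[μ] F j) (hFi : ∀ j, Integrable (F j) μ)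
    (hlim : ∀ᵐ ω ∂μ, Tendsto (fun j => F j ω) atTop (𝓝 (G ω))) (hle : ∀ j, ∫ ω, F j ω ∂μ ≤ c) :
    Integrable G μ ∧ ∫ ω, G ω ∂μ ≤ c := by
  have hGm : AEStronglyMeasurable G μ :=
    aestronglyMeasurable_of_tendsto_ae atTop (fun j => (hFi j).aestronglyMeasurable) hlim
  have hG0 : 0 ≤ᵐ[μ] G := by
    filter_upwards [hlim, ae_all_iff.2 hF0] with ω h1 h2 using ge_of_tendsto' h1 h2
  have hc : 0 ≤ c := (integral_nonneg_of_ae (hF0 0)).trans (hle 0)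
  have h1 : ∫⁻ ω, ENNReal.ofReal (G ω) ∂μ ≤ ENNReal.ofReal c := by
    calc ∫⁻ ω, ENNReal.ofReal (G ω) ∂μ
        = ∫⁻ ω, liminf (fun j => ENNReal.ofReal (F j ω)) atTop ∂μ := by
          refine lintegral_congr_ae ?_
          filter_upwards [hlim] with ω h
          exact ((ENNReal.continuous_ofReal.tendsto _).comp h).liminf_eq.symm
      _ ≤ liminf (fun j => ∫⁻ ω, ENNReal.ofReal (F j ω) ∂μ) atTop :=
          lintegral_liminf_le' fun j => (hFi j).aemeasurable.ennreal_ofReal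
      _ ≤ liminf (fun _ : ℕ => ENNReal.ofReal c) atTop := by
          refine liminf_le_liminf (Eventually.of_forall fun j => ?_)
          rw [← ofReal_integral_eq_lintegral_ofReal (hFi j) (hF0 j)]
          exact ENNReal.ofReal_le_ofReal (hle j)
      _ = ENNReal.ofReal c := liminf_const _
  have hGi : Integrable G μ := by
    refine ⟨hGm, ?_⟩
    rw [hasFiniteIntegral_iff_ofReal hG0]
    exact h1.trans_lt ENNReal.ofReal_lt_top
  refine ⟨hGi, ?_⟩
  rw [← ofReal_integral_eq_lintegral_ofReal hGi hG0] at h1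
  exact (ENNReal.ofReal_le_ofReal_iff hc).1 h1

variable {E : Type*}

/-- The growth bound, uniform in `j`, permits a single integrable minorant in Fatou's lemma. The
σ-algebra is a free argument so that it can be that of the past. -/
lemma exists_finite_valued_approx {Ω : Type*} {_ : MeasurableSpace Ω} [NormedAddCommGroup E]
    [SecondCountableTopology E] [MeasurableSpace E] [BorelSpace E] {K : Set E} {y₀ : E}
    (hy₀ : y₀ ∈ K) {Y : Ω → E} (hY : Measurable Y) (hYK : ∀ ω, Y ω ∈ K) :
    ∃ S : ℕ → Ω → E, (∀ j, ∃ F : Finset E, ∀ ω, S j ω ∈ F) ∧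
      (∀ j y, MeasurableSet (S j ⁻¹' {y})) ∧ (∀ j ω, S j ω ∈ K) ∧
      (∀ ω, Tendsto (fun j => S j ω) atTop (𝓝 (Y ω))) ∧
      ∀ j ω, ‖S j ω - y₀‖ ≤ 2 * ‖Y ω - y₀‖ := by
  refine ⟨fun j => SimpleFunc.approxOn Y hY K y₀ hy₀ j, fun j =>
    ⟨_, SimpleFunc.mem_range_self (SimpleFunc.approxOn Y hY K y₀ hy₀ j)⟩,
    fun j y => SimpleFunc.measurableSet_fiber _ y,
    fun j ω => SimpleFunc.approxOn_mem hY hy₀ j ω,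
    fun ω => SimpleFunc.tendsto_approxOn hY hy₀ (subset_closure (hYK ω)), fun j ω => ?_⟩
  have h := SimpleFunc.edist_approxOn_y0_le hY hy₀ ω j
  rw [edist_dist, edist_dist, ← ENNReal.ofReal_add dist_nonneg dist_nonneg,
    ENNReal.ofReal_le_ofReal_iff (by positivity), dist_comm, dist_comm y₀, dist_eq_norm,
    dist_eq_norm, ← two_mul] at h
  exact h

/-- On each fibre of `S` the point is constant, and intersecting `A` with the fibre stays in `m`. -/
lemma setIntegral_finite_valued_comp_nonpos (hm : m ≤ mΩ) {K : Set E}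
    {D : Ω → E → ℝ} (hDi : ∀ y ∈ K, Integrable (fun ω => D ω y) μ)
    (hD : ∀ y ∈ K, ∀ A, MeasurableSet[m] A → ∫ ω in A, D ω y ∂μ ≤ 0)
    {S : Ω → E} {F : Finset E} (hF : ∀ ω, S ω ∈ F) (hSm : ∀ y, MeasurableSet[m] (S ⁻¹' {y}))
    (hS : ∀ ω, S ω ∈ K) :
    Integrable (fun ω => D ω (S ω)) μ ∧
      ∀ A, MeasurableSet[m] A → ∫ ω in A, D ω (S ω) ∂μ ≤ 0 := by
  classical
  set F' := F.filter (· ∈ K) with hF'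
  have hdec : ∀ ω, D ω (S ω) = ∑ y ∈ F', (S ⁻¹' {y}).indicator (fun ω => D ω y) ω := by
    intro ω
    rw [Finset.sum_eq_single (S ω)]
    · simp
    · intro y _ hy
      exact Set.indicator_of_notMem (fun h => hy h.symm) _
    · intro h
      exact absurd (Finset.mem_filter.2 ⟨hF ω, hS ω⟩) h
  have hmemK : ∀ y ∈ F', y ∈ K := fun y hy => (Finset.mem_filter.1 hy).2
  have hi : ∀ y ∈ F', Integrable ((S ⁻¹' {y}).indicator fun ω => D ω y) μ := fun y hy =>
    (hDi y (hmemK y hy)).indicator (hm _ (hSm y))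
  simp_rw [hdec]
  refine ⟨integrable_finsetSum _ hi, fun A hA => ?_⟩
  rw [integral_finsetSum _ fun y hy => (hi y hy).integrableOn]
  refine Finset.sum_nonpos fun y hy => ?_
  rw [setIntegral_indicator (hm _ (hSm y))]
  exact hD y (hmemK y hy) _ (hA.inter (hSm y))

/-- An integral inequality valid for all constant points of `K` extends to measurable selections
of `K`. -/
lemma setIntegral_comp_nonpos [NormedAddCommGroup E] [SecondCountableTopology E]
    [MeasurableSpace E] [BorelSpace E] (hm : m ≤ mΩ) {K : Set E} {y₀ : E} (hy₀ : y₀ ∈ K)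
    {D : Ω → E → ℝ} (hDi : ∀ y ∈ K, Integrable (fun ω => D ω y) μ)
    (hD : ∀ y ∈ K, ∀ A, MeasurableSet[m] A → ∫ ω in A, D ω y ∂μ ≤ 0)
    (hcont : ∀ᵐ ω ∂μ, ContinuousOn (D ω) K) {Y : Ω → E} (hY : Measurable[m] Y)
    (hYK : ∀ ω, Y ω ∈ K) {T : Ω → ℝ} (hT : Integrable T μ)
    (hlow : ∀ᵐ ω ∂μ, ∀ y ∈ K, ‖y - y₀‖ ≤ 2 * ‖Y ω - y₀‖ → -T ω ≤ D ω y) :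
    Integrable (fun ω => D ω (Y ω)) μ ∧
      ∀ A, MeasurableSet[m] A → ∫ ω in A, D ω (Y ω) ∂μ ≤ 0 := by
  obtain ⟨S, hSF, hSm, hSK, hSlim, hSle⟩ := exists_finite_valued_approx hy₀ hY hYK
  have hS : ∀ j, Integrable (fun ω => D ω (S j ω)) μ ∧
      ∀ A, MeasurableSet[m] A → ∫ ω in A, D ω (S j ω) ∂μ ≤ 0 := fun j => by
    obtain ⟨F, hF⟩ := hSF j
    exact setIntegral_finite_valued_comp_nonpos hm hDi hD hF (hSm j) (hSK j)
  have hlim : ∀ᵐ ω ∂μ, Tendsto (fun j => D ω (S j ω) + T ω) atTop (𝓝 (D ω (Y ω) + T ω)) := by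
    filter_upwards [hcont] with ω h
    refine Tendsto.add_const _ ((h (Y ω) (hYK ω)).tendsto.comp ?_)
    exact tendsto_nhdsWithin_iff.2 ⟨hSlim ω, Eventually.of_forall fun j => hSK j ω⟩
  have h0 : ∀ j, 0 ≤ᵐ[μ] fun ω => D ω (S j ω) + T ω := fun j => by
    filter_upwards [hlow] with ω h
    have := h _ (hSK j ω) (hSle j ω)
    simp only [Pi.zero_apply]
    linarith
  have key : ∀ A, MeasurableSet[m] A → IntegrableOn (fun ω => D ω (Y ω) + T ω) A μ ∧
      ∫ ω in A, (D ω (Y ω) + T ω) ∂μ ≤ ∫ ω in A, T ω ∂μ := by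
    intro A hA
    refine integrable_and_integral_le_of_tendsto (fun j => ae_restrict_of_ae (h0 j))
      (fun j => ((hS j).1.add hT).integrableOn) (ae_restrict_of_ae hlim) fun j => ?_
    rw [integral_add (hS j).1.integrableOn hT.integrableOn]
    linarith [(hS j).2 A hA]
  have hi : Integrable (fun ω => D ω (Y ω)) μ := by
    have h := (key Set.univ MeasurableSet.univ).1
    rw [integrableOn_univ] at h
    exact (h.sub hT).congr (Eventually.of_forall fun ω => add_sub_cancel_right _ _)
  refine ⟨hi, fun A hA => ?_⟩
  have h := (key A hA).2
  rw [integral_add hi.integrableOn hT.integrableOn] at h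
  linarith

end Fatou

/-! ### Extended-real bookkeeping for the composite objective -/

section Composite

variable {E : Type*} {f : E → ℝ} {φ : E → EReal}

lemma effDom_compositeObj (hbot : ∀ y, φ y ≠ ⊥) : effDom (compositeObj f φ) = effDom φ := by
  ext y
  simp only [effDom, compositeObj, Set.mem_ofPred_eq]
  induction h : φ y with
  | bot => exact absurd h (hbot y)
  | coe a => simp [← EReal.coe_add, EReal.coe_lt_top]
  | top => simp

lemma compositeObj_ne_bot (hbot : ∀ y, φ y ≠ ⊥) (y : E) : compositeObj f φ y ≠ ⊥ := by
  simp [compositeObj, EReal.add_eq_bot_iff, hbot y]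

lemma toReal_compositeObj (hbot : ∀ y, φ y ≠ ⊥) {y : E} (hy : y ∈ effDom φ) :
    (compositeObj f φ y).toReal = f y + (φ y).toReal := by
  rw [compositeObj, EReal.toReal_add (EReal.coe_ne_top _) (EReal.coe_ne_bot _) (ne_of_lt hy)
    (hbot y), EReal.toReal_coe]

/-- At a limit point outside the domain, lower semicontinuity would force arbitrarily large values
nearby, while the Lipschitz bound keeps them bounded. -/
lemma isClosed_effDom [NormedAddCommGroup E] {L : ℝ≥0} (hbot : ∀ y, φ y ≠ ⊥)
    (hne : (effDom φ).Nonempty)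
    (hlsc : LowerSemicontinuous φ) (hlip : LipschitzOnWith L (fun y => (φ y).toReal) (effDom φ)) :
    IsClosed (effDom φ) := by
  obtain ⟨y₀, hy₀⟩ := hne
  refine isClosed_of_closure_subset fun x hx => ?_
  by_contra hxK
  have hxt : φ x = ⊤ := by simpa [effDom] using hxK
  set M : ℝ := (φ y₀).toReal + L * (‖x - y₀‖ + 1) with hM
  have h1 : ∀ᶠ y in 𝓝 x, (M : EReal) < φ y := hlsc x M (show (M : EReal) < φ x from hxt ▸ EReal.coe_lt_top M)
  have h2 : ∀ᶠ y in 𝓝 x, dist y x < 1 := Metric.ball_mem_nhds x one_pos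
  obtain ⟨y, hyK, hy1, hy2⟩ := ((mem_closure_iff_frequently.1 hx).and_eventually (h1.and h2)).exists
  have h3 := (le_abs_self _).trans (hlip.norm_sub_le hyK hy₀)
  rw [← EReal.coe_toReal (ne_of_lt hyK) (hbot y), EReal.coe_lt_coe_iff] at hy1
  rw [dist_eq_norm] at hy2
  have h4 : ‖y - y₀‖ ≤ ‖x - y₀‖ + 1 := by
    have : y - y₀ = (y - x) + (x - y₀) := by abel
    rw [this]
    linarith [norm_add_le (y - x) (x - y₀)]
  have h5 := mul_le_mul_of_nonneg_left h4 L.2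
  simp only [NNReal.val_eq_coe] at h5
  linarith

lemma IsMinOn.mem_effDom_and_le [NormedAddCommGroup E] {H : E → ℝ} {α : ℝ} {x p : E}
    (hbot : ∀ y, φ y ≠ ⊥) (hne : (effDom φ).Nonempty)
    (hp : IsMinOn (fun y => ((H y : ℝ) : EReal) + φ y
        + ((1 / (2 * α) * ‖y - x‖ ^ 2 : ℝ) : EReal)) Set.univ p) :
    p ∈ effDom φ ∧ ∀ y ∈ effDom φ, H p + (φ p).toReal + 1 / α / 2 * ‖p - x‖ ^ 2
      ≤ H y + (φ y).toReal + 1 / α / 2 * ‖y - x‖ ^ 2 := by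
  have hval : ∀ y ∈ effDom φ, ((H y : ℝ) : EReal) + φ y
        + ((1 / (2 * α) * ‖y - x‖ ^ 2 : ℝ) : EReal)
      = ((H y + (φ y).toReal + 1 / α / 2 * ‖y - x‖ ^ 2 : ℝ) : EReal) := by
    intro y hy
    rw [EReal.coe_add, EReal.coe_add, EReal.coe_toReal (ne_of_lt hy) (hbot y)]
    congr 3
    rw [div_div, mul_comm]
  have hle := fun y => hp (Set.mem_univ y)
  simp only [Set.mem_ofPred_eq] at hle
  have hpK : p ∈ effDom φ := by
    obtain ⟨y₀, hy₀⟩ := hne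
    by_contra hpt
    have : φ p = ⊤ := by simpa [effDom] using hpt
    have h := hle y₀
    rw [hval y₀ hy₀, this, EReal.coe_add_top, EReal.top_add_coe, top_le_iff] at h
    exact EReal.coe_ne_top _ h
  refine ⟨hpK, fun y hy => ?_⟩
  have h := hle y
  rw [hval y hy, hval p hpK] at h
  exact EReal.coe_le_coe_iff.1 h

end Composite

/-! ### Deterministic estimates for one subproblem -/

section Step

variable {E : Type*} [NormedAddCommGroup E] [InnerProductSpace ℝ E] {K : Set E}
  {H φ : E → ℝ} {x p g : E} {α η ρ : ℝ} {Lφ : ℝ≥0}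

/-- A rough bound for the step, valid also when the current point is not feasible. -/
lemma prox_step_sq_le (hα : 0 < α) (hαη : α * η < 1) {b : ℝ} (hb : b ≤ φ p) {y : E}
    (hmin : H p + φ p + 1 / α / 2 * ‖p - x‖ ^ 2 ≤ H y + φ y + 1 / α / 2 * ‖y - x‖ ^ 2)
    (hsub : H x + inner ℝ g (p - x) - η / 2 * ‖p - x‖ ^ 2 ≤ H p) :
    ‖p - x‖ ^ 2 ≤ 2 / (1 / α - η) * (2 * (H y - H x + φ y - b) + 1 / α * ‖y - x‖ ^ 2
      + 2 / (1 / α - η) * ‖g‖ ^ 2) := by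
  have ha : 0 < 1 / α - η := by
    rw [sub_pos, lt_div_iff₀ hα]; linarith
  set a := 1 / α - η with hadef
  have h1 := (abs_le.1 (abs_real_inner_le_norm g (p - x))).1
  have h2 : 2 * (‖g‖ * ‖p - x‖) ≤ a / 2 * ‖p - x‖ ^ 2 + 2 / a * ‖g‖ ^ 2 := by
    have : 0 ≤ 1 / (2 * a) * (a * ‖p - x‖ - 2 * ‖g‖) ^ 2 := by positivity
    have e : 1 / (2 * a) * (a * ‖p - x‖ - 2 * ‖g‖) ^ 2
        = a / 2 * ‖p - x‖ ^ 2 + 2 / a * ‖g‖ ^ 2 - 2 * (‖g‖ * ‖p - x‖) := by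
      field_simp; ring
    linarith
  have h3 : a / 2 * ‖p - x‖ ^ 2 ≤ 2 * (H y - H x + φ y - b) + 1 / α * ‖y - x‖ ^ 2
      + 2 / a * ‖g‖ ^ 2 := by
    have : a * ‖p - x‖ ^ 2 = 1 / α * ‖p - x‖ ^ 2 - η * ‖p - x‖ ^ 2 := by rw [hadef]; ring
    linarith
  have h4 := mul_le_mul_of_nonneg_left h3 (by positivity : 0 ≤ 2 / a)
  have e : 2 / a * (a / 2 * ‖p - x‖ ^ 2) = ‖p - x‖ ^ 2 := by field_simp
  rwa [e] at h4

lemma model_add_ge (hφ : LipschitzOnWith Lφ φ K) (hx : x ∈ K) (hp : p ∈ K)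
    (hsub : H x + inner ℝ g (p - x) - η / 2 * ‖p - x‖ ^ 2 ≤ H p) :
    H x + φ x - (‖g‖ + Lφ) * ‖p - x‖ - η / 2 * ‖p - x‖ ^ 2 ≤ H p + φ p := by
  have h1 := (abs_le.1 (abs_real_inner_le_norm g (p - x))).1
  have h2 := (abs_le.1 (hφ.norm_sub_le hp hx)).1
  linarith

/-- The competitor is `x` itself; the smallness of `α η` keeps half of the quadratic, and one factor
`‖p - x‖` cancels. -/
lemma prox_step_norm_le (hα : 0 < α) (hαη : α * η ≤ 1 / 2) (hφ : LipschitzOnWith Lφ φ K)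
    (hx : x ∈ K) (hp : p ∈ K)
    (hmin : ∀ y ∈ K, H p + φ p + 1 / α / 2 * ‖p - x‖ ^ 2 ≤ H y + φ y + 1 / α / 2 * ‖y - x‖ ^ 2)
    (hsub : H x + inner ℝ g (p - x) - η / 2 * ‖p - x‖ ^ 2 ≤ H p) :
    ‖p - x‖ ≤ 4 * α * (‖g‖ + Lφ) := by
  have h1 := model_add_ge hφ hx hp hsub
  have h2 := hmin x hx
  rw [sub_self, norm_zero] at h2
  have h3 : 1 / α * ‖p - x‖ ^ 2 - η * ‖p - x‖ ^ 2 ≤ 2 * ((‖g‖ + Lφ) * ‖p - x‖) := by linarith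
  have h4 := mul_le_mul_of_nonneg_left h3 hα.le
  have e : α * (1 / α * ‖p - x‖ ^ 2 - η * ‖p - x‖ ^ 2)
      = (1 - α * η) * ‖p - x‖ ^ 2 := by field_simp
  rw [e] at h4
  have h5 : 1 / 2 * ‖p - x‖ ^ 2 ≤ (1 - α * η) * ‖p - x‖ ^ 2 :=
    mul_le_mul_of_nonneg_right (by linarith) (sq_nonneg _)
  rcases (norm_nonneg (p - x)).eq_or_lt with h0 | h0
  · rw [← h0]; have := Lφ.2; have := norm_nonneg g; positivity
  · refine le_of_mul_le_mul_left ?_ h0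
    linarith

/-- Quadratic growth of the subproblem at `p`, with the model at `p` replaced by its value at `x`.
The resulting term linear in `‖p - x‖` is absorbed by completing the square. -/
lemma prox_step_descent (hα : 0 < α) (hαη : α * η ≤ 1 / 2) (hφ : LipschitzOnWith Lφ φ K)
    (hHc : ConvexOn ℝ Set.univ fun y => H y + η / 2 * ‖y‖ ^ 2)
    (hφc : ConvexOn ℝ K fun y => φ y + ρ / 2 * ‖y‖ ^ 2)
    (hx : x ∈ K) (hp : p ∈ K)
    (hmin : ∀ y ∈ K, H p + φ p + 1 / α / 2 * ‖p - x‖ ^ 2 ≤ H y + φ y + 1 / α / 2 * ‖y - x‖ ^ 2)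
    (hsub : H x + inner ℝ g (p - x) - η / 2 * ‖p - x‖ ^ 2 ≤ H p) {z : E} (hz : z ∈ K) :
    (1 - α * (η + ρ)) * ‖z - p‖ ^ 2 ≤ ‖z - x‖ ^ 2 + 2 * α * (H z - H x + φ z - φ x)
      + 2 * α ^ 2 * (‖g‖ + Lφ) ^ 2 := by
  have hc : ConvexOn ℝ K fun y => (H y + φ y) + (η + ρ) / 2 * ‖y‖ ^ 2 := by
    refine ((hHc.subset (Set.subset_univ K) hφc.1).add hφc).congr fun y _ => ?_
    simp only [Pi.add_apply]
    ring
  have h1 := hc.prox_growth hp hmin hz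
  have h2 := model_add_ge hφ hx hp hsub
  have h3 : 1 / α * ‖p - x‖ ^ 2 + (1 / α - (η + ρ)) * ‖z - p‖ ^ 2
      ≤ 2 * (H z - H x + φ z - φ x) + 1 / α * ‖z - x‖ ^ 2 + 2 * ((‖g‖ + Lφ) * ‖p - x‖)
        + η * ‖p - x‖ ^ 2 := by linarith
  have h4 := mul_le_mul_of_nonneg_left h3 hα.le
  have e1 : α * (1 / α * ‖p - x‖ ^ 2 + (1 / α - (η + ρ)) * ‖z - p‖ ^ 2)
      = ‖p - x‖ ^ 2 + (1 - α * (η + ρ)) * ‖z - p‖ ^ 2 := by field_simp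
  have e2 : α * (2 * (H z - H x + φ z - φ x) + 1 / α * ‖z - x‖ ^ 2 + 2 * ((‖g‖ + Lφ) * ‖p - x‖)
        + η * ‖p - x‖ ^ 2) = 2 * α * (H z - H x + φ z - φ x) + ‖z - x‖ ^ 2
        + 2 * (α * (‖g‖ + Lφ)) * ‖p - x‖ + α * η * ‖p - x‖ ^ 2 := by field_simp
  rw [e1, e2] at h4
  have h5 : α * η * ‖p - x‖ ^ 2 ≤ 1 / 2 * ‖p - x‖ ^ 2 :=
    mul_le_mul_of_nonneg_right hαη (sq_nonneg _)
  nlinarith [sq_nonneg (2 * (α * (‖g‖ + Lφ)) - ‖p - x‖)]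

end Step

/-! ### Descent of the envelope along one step -/

section OneStep

variable {E : Type*} [NormedAddCommGroup E] [InnerProductSpace ℝ E] {K : Set E}
  {H φ f : E → ℝ} {x p g : E} {α η ρ τ θ : ℝ} {Lφ : ℝ≥0} {P : E → E}

lemma IsProxMap.env_step_descent (hP : IsProxMap θ (fun y => f y + φ y) K P) (hθ : 0 < θ)
    (hθm : θ * (η + ρ + τ) < 1) (hρ : 0 ≤ ρ) (hη : 0 ≤ η)
    (hψc : ConvexOn ℝ K fun y => (f y + φ y) + (η + ρ + τ) / 2 * ‖y‖ ^ 2)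
    (hα : 0 < α) (hαs : α * (η + ρ) ≤ 1 / 2) (hφ : LipschitzOnWith Lφ φ K)
    (hHc : ConvexOn ℝ Set.univ fun y => H y + η / 2 * ‖y‖ ^ 2)
    (hφc : ConvexOn ℝ K fun y => φ y + ρ / 2 * ‖y‖ ^ 2)
    (hx : x ∈ K) (hp : p ∈ K)
    (hmin : ∀ y ∈ K, H p + φ p + 1 / α / 2 * ‖p - x‖ ^ 2 ≤ H y + φ y + 1 / α / 2 * ‖y - x‖ ^ 2)
    (hsub : H x + inner ℝ g (p - x) - η / 2 * ‖p - x‖ ^ 2 ≤ H p) :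
    f (P p) + φ (P p) + 1 / θ / 2 * ‖P p - p‖ ^ 2 ≤ f (P x) + φ (P x) + 1 / θ / 2 * ‖P x - x‖ ^ 2
      - α * (1 - θ * (η + ρ + τ)) * ‖(1 / θ) • (x - P x)‖ ^ 2
      + α / (θ * (1 - α * (η + ρ))) *
        ((H (P x) - f (P x) - τ / 2 * ‖x - P x‖ ^ 2) - (H x - f x))
      + 2 / θ * α ^ 2 * (‖g‖ + Lφ) ^ 2 := by
  have hαη : α * η ≤ 1 / 2 := by nlinarith [mul_nonneg hα.le hρ]
  have h1 := prox_step_descent hα hαη hφ hHc hφc hx hp hmin hsub (hP x).1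
  have h2 := hP.growth hψc x hx
  rw [sub_self, norm_zero, norm_sub_rev x (P x)] at h2
  have h3 := (hP p).2 _ (hP x).1
  simp only at h2 h3
  set z := P x
  rw [norm_smul, mul_pow, norm_sub_rev x z, Real.norm_eq_abs, sq_abs]
  set u := ‖z - x‖ ^ 2 with hu
  set v := ‖z - p‖ ^ 2
  -- All randomness of the model is collected here: the first bracket will have nonpositive
  -- conditional mean, the second mean zero.
  set S := (H z - f z - τ / 2 * u) - (H x - f x) with hS
  set l := 1 - α * (η + ρ) with hl
  have hl1 : 1 / 2 ≤ l := by rw [hl]; linarith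
  have hl2 : l ≤ 1 := by
    rw [hl]; linarith [mul_nonneg hα.le (add_nonneg hη hρ)]
  have hl0 : 0 < l := by linarith
  have hu0 : 0 ≤ u := sq_nonneg _
  have hq : 0 ≤ 1 / θ - (η + ρ + τ) := by
    rw [sub_nonneg, le_div_iff₀ hθ]; linarith
  set q := 1 / θ - (η + ρ + τ) with hqdef
  set G := (‖g‖ + (Lφ : ℝ)) ^ 2
  have hG : 0 ≤ G := sq_nonneg _
  -- Growth at `z` contributes `1 / θ + q = 2 q + η + ρ + τ`: the `τ` cancels the accuracy error,
  -- and `η + ρ` makes the coefficient of `u` match the `l` on the left.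
  have h4 : l * v ≤ l * u - 2 * α * q * u + 2 * α * S + 2 * α ^ 2 * G := by
    have h5 := mul_le_mul_of_nonneg_left h2 hα.le
    have e : l * u - 2 * α * q * u + 2 * α * S
        = u + 2 * α * (H z - H x) + 2 * α * (f x - f z)
          - 2 * (α * (1 / θ / 2 * u + q / 2 * u)) := by
      rw [hl, hqdef, hS]; ring
    rw [e]
    linarith
  have h5 : v ≤ u - 2 * α * q * u + 2 * α / l * S + 4 * α ^ 2 * G := by
    refine le_of_mul_le_mul_left (h4.trans ?_) hl0
    have e : l * (u - 2 * α * q * u + 2 * α / l * S + 4 * α ^ 2 * G)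
        = l * u - l * (2 * α * q * u) + 2 * α * S + l * (4 * α ^ 2 * G) := by
      field_simp
    rw [e]
    have t1 : l * (2 * α * q * u) ≤ 2 * α * q * u :=
      mul_le_of_le_one_left (by positivity) hl2
    have t2 : 1 / 2 * (4 * α ^ 2 * G) ≤ l * (4 * α ^ 2 * G) :=
      mul_le_mul_of_nonneg_right hl1 (by positivity)
    linarith
  have h6 := mul_le_mul_of_nonneg_left h5 (by positivity : 0 ≤ 1 / θ / 2)
  have e1 : 1 / θ / 2 * (u - 2 * α * q * u + 2 * α / l * S + 4 * α ^ 2 * G)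
      = 1 / θ / 2 * u - α * (1 - θ * (η + ρ + τ)) * ((1 / θ) ^ 2 * u)
        + α / (θ * l) * S + 2 / θ * α ^ 2 * G := by
    rw [hqdef]; field_simp; ring
  linarith

end OneStep

/-- Turns the pathwise inequality into its conditional form, tested on events `A`: `D` is the model
error at the proximal point, `N` that at the iterate, `G` the squared subgradient. -/
lemma setIntegral_descent {Ω : Type*} [MeasurableSpace Ω] {μ : Measure Ω}
    {e e' Q D N G : Ω → ℝ} {a b c₁ c₂ c₃ : ℝ} {A : Set Ω} (hb : 0 ≤ b)
    (hc₁ : 0 ≤ c₁)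
    (he : Integrable e μ) (he' : Integrable e' μ) (hQ : Integrable Q μ) (hD : Integrable D μ)
    (hN : Integrable N μ) (hG : Integrable G μ)
    (h : ∀ᵐ ω ∂μ, e' ω ≤ e ω - a * Q ω + b * (D ω - N ω) + (c₁ * G ω + c₂ * e ω))
    (hDA : ∫ ω in A, D ω ∂μ ≤ 0) (hNA : ∫ ω in A, N ω ∂μ = 0)
    (hGA : ∫ ω in A, G ω ∂μ ≤ c₃ * ∫ ω in A, e ω ∂μ) :
    ∫ ω in A, e' ω ∂μ ≤ (1 + (c₁ * c₃ + c₂)) * ∫ ω in A, e ω ∂μ - a * ∫ ω in A, Q ω ∂μ := by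
  have i1 : Integrable (fun ω => e ω - a * Q ω) (μ.restrict A) :=
    (he.sub (hQ.const_mul a)).integrableOn
  have i2 : Integrable (fun ω => b * (D ω - N ω)) (μ.restrict A) :=
    ((hD.sub hN).const_mul b).integrableOn
  have i3 : Integrable (fun ω => c₁ * G ω + c₂ * e ω) (μ.restrict A) :=
    ((hG.const_mul c₁).add (he.const_mul c₂)).integrableOn
  have i12 : Integrable (fun ω => e ω - a * Q ω + b * (D ω - N ω)) (μ.restrict A) := i1.add i2
  have h1 := integral_mono_ae he'.integrableOn (i12.add i3) (ae_restrict_of_ae (s := A) h)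
  simp only [Pi.add_apply] at h1
  rw [integral_add i12 i3, integral_add i1 i2,
    integral_sub he.integrableOn (hQ.const_mul a).integrableOn,
    integral_add (hG.const_mul c₁).integrableOn (he.const_mul c₂).integrableOn,
    integral_const_mul, integral_const_mul, integral_const_mul, integral_const_mul,
    integral_sub hD.integrableOn hN.integrableOn, hNA, sub_zero] at h1
  have h2 := mul_nonpos_of_nonneg_of_nonpos hb hDA
  have h3 := mul_le_mul_of_nonneg_left hGA hc₁
  linarith

/-! ### Square integrability and model accuracy at random points -/

section Model

variable {Ω : Type*} {m : MeasurableSpace Ω} [mΩ : MeasurableSpace Ω] {μ : Measure Ω}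
  [IsProbabilityMeasure μ] {E : Type*} [NormedAddCommGroup E] [InnerProductSpace ℝ E]
  {K : Set E} {H : Ω → E → ℝ} {X X' g : Ω → E} {η : ℝ}

/-- The competitor is a fixed feasible `y₀`, since the current iterate may be infeasible. -/
lemma memLp_prox_step {φ : E → ℝ} {α b : ℝ} (hα : 0 < α) (hαη : α * η < 1) {y₀ : E}
    (hX : MemLp X 2 μ) (hg : MemLp g 2 μ) (hX' : AEStronglyMeasurable X' μ)
    (hHX : Integrable (fun ω => H ω (X ω)) μ) (hHy : Integrable (fun ω => H ω y₀) μ)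
    (hb : ∀ᵐ ω ∂μ, b ≤ φ (X' ω))
    (hmin : ∀ᵐ ω ∂μ, H ω (X' ω) + φ (X' ω) + 1 / α / 2 * ‖X' ω - X ω‖ ^ 2
      ≤ H ω y₀ + φ y₀ + 1 / α / 2 * ‖y₀ - X ω‖ ^ 2)
    (hsub : ∀ᵐ ω ∂μ, ∀ y, H ω (X ω) + inner ℝ (g ω) (y - X ω) - η / 2 * ‖y - X ω‖ ^ 2 ≤ H ω y) :
    MemLp X' 2 μ := by
  have h1 : MemLp (fun ω => X' ω - X ω) 2 μ := by
    refine (memLp_two_iff_integrable_sq_norm (hX'.sub hX.1)).2 ?_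
    have hint : Integrable (fun ω => 2 / (1 / α - η) * (2 * (H ω y₀ - H ω (X ω) + φ y₀ - b)
        + 1 / α * ‖y₀ - X ω‖ ^ 2 + 2 / (1 / α - η) * ‖g ω‖ ^ 2)) μ := by
      have i1 : Integrable (fun ω => ‖y₀ - X ω‖ ^ 2) μ :=
        ((memLp_const y₀).sub hX).integrable_norm_pow two_ne_zero
      have i2 : Integrable (fun ω => ‖g ω‖ ^ 2) μ := hg.integrable_norm_pow two_ne_zero
      have i3 : Integrable (fun ω => H ω y₀ - H ω (X ω) + φ y₀ - b) μ :=
        ((hHy.sub hHX).add (integrable_const _)).sub (integrable_const _)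
      exact (((i3.const_mul 2).add (i1.const_mul _)).add (i2.const_mul _)).const_mul _
    refine hint.mono' ((hX'.sub hX.1).norm.pow 2) ?_
    filter_upwards [hb, hmin, hsub] with ω h1 h2 h3
    rw [Real.norm_eq_abs, abs_of_nonneg (sq_nonneg _)]
    exact prox_step_sq_le hα hαη h1 h2 (h3 _)
  exact (h1.add hX).ae_eq (Eventually.of_forall fun ω => sub_add_cancel _ _)

/-- The one-sided accuracy of the model extends from deterministic points of `K` to measurable
selections of `K`. -/
lemma setIntegral_model_accuracy [SecondCountableTopology E] [MeasurableSpace E] [BorelSpace E]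
    (hm : m ≤ mΩ) {f : E → ℝ} {τ c₀ c₁ : ℝ} (hη : 0 ≤ η) (hτ : 0 ≤ τ) (hc₁ : 0 ≤ c₁) {y₀ : E}
    (hy₀ : y₀ ∈ K) (hX : MemLp X 2 μ) (hg : MemLp g 2 μ)
    (hHX : Integrable (fun ω => H ω (X ω)) μ)
    (hHi : ∀ y ∈ K, Integrable (fun ω => H ω y) μ)
    (hacc : ∀ y ∈ K, μ[fun ω => H ω y - f y | m] ≤ᵐ[μ] fun ω => τ / 2 * ‖X ω - y‖ ^ 2)
    (hcont : ∀ᵐ ω ∂μ, Continuous (H ω))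
    (hsub : ∀ᵐ ω ∂μ, ∀ y, H ω (X ω) + inner ℝ (g ω) (y - X ω) - η / 2 * ‖y - X ω‖ ^ 2 ≤ H ω y)
    (hf : ContinuousOn f K) (hfg : ∀ y ∈ K, |f y| ≤ c₀ + c₁ * ‖y - y₀‖ ^ 2)
    {Y : Ω → E} (hY : Measurable[m] Y) (hYK : ∀ ω, Y ω ∈ K) (hY2 : MemLp Y 2 μ) :
    Integrable (fun ω => H ω (Y ω) - f (Y ω) - τ / 2 * ‖X ω - Y ω‖ ^ 2) μ ∧
      ∀ A, MeasurableSet[m] A →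
        ∫ ω in A, (H ω (Y ω) - f (Y ω) - τ / 2 * ‖X ω - Y ω‖ ^ 2) ∂μ ≤ 0 := by
  have hXy : ∀ y, Integrable (fun ω => τ / 2 * ‖X ω - y‖ ^ 2) μ := fun y =>
    ((hX.sub (memLp_const y)).integrable_norm_pow two_ne_zero).const_mul _
  have hsL : MemLp (fun ω => 2 * ‖Y ω - y₀‖ + ‖X ω - y₀‖) 2 μ :=
    ((hY2.sub (memLp_const y₀)).norm.const_mul 2).add (hX.sub (memLp_const y₀)).norm
  -- An integrable minorant up to sign, valid for all `y` with `‖y - y₀‖ ≤ 2 ‖Y - y₀‖`: subgradient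
  -- inequality, Young's inequality and quadratic growth of `f`.
  have hT : Integrable (fun ω => |H ω (X ω)| + ‖g ω‖ ^ 2
      + (1 + η / 2 + τ / 2) * (2 * ‖Y ω - y₀‖ + ‖X ω - y₀‖) ^ 2
      + (c₀ + c₁ * (4 * ‖Y ω - y₀‖ ^ 2))) μ := by
    have i1 : Integrable (fun ω => ‖g ω‖ ^ 2) μ := hg.integrable_norm_pow two_ne_zero
    have i2 : Integrable (fun ω => ‖Y ω - y₀‖ ^ 2) μ :=
      (hY2.sub (memLp_const y₀)).integrable_norm_pow two_ne_zero
    exact ((hHX.abs.add i1).add (hsL.integrable_sq.const_mul _)).add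
      ((integrable_const _).add ((i2.const_mul 4).const_mul c₁))
  refine setIntegral_comp_nonpos (D := fun ω y => H ω y - f y - τ / 2 * ‖X ω - y‖ ^ 2) hm hy₀
    (fun y hy => ((hHi y hy).sub (integrable_const _)).sub (hXy y)) (fun y hy A hA => ?_) ?_ hY hYK
    hT ?_
  · have i : Integrable (fun ω => H ω y - f y) μ := (hHi y hy).sub (integrable_const _)
    rw [integral_sub i.integrableOn (hXy y).integrableOn, sub_nonpos,
      ← setIntegral_condExp hm i hA]
    exact setIntegral_mono_ae integrable_condExp.integrableOn (hXy y).integrableOn (hacc y hy)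
  · filter_upwards [hcont] with ω h
    exact (h.continuousOn.sub hf).sub (by fun_prop)
  · filter_upwards [hsub] with ω h y hy hyY
    have h1 := h y
    have h2 := (abs_le.1 (abs_real_inner_le_norm (g ω) (y - X ω))).1
    have h3 := (abs_le.1 (hfg y hy)).2
    have h4 := neg_abs_le (H ω (X ω))
    set s := 2 * ‖Y ω - y₀‖ + ‖X ω - y₀‖ with hs
    have h5 : ‖y - X ω‖ ≤ s := by
      have : y - X ω = (y - y₀) - (X ω - y₀) := by abel
      rw [this]
      linarith [norm_sub_le (y - y₀) (X ω - y₀)]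
    have h6 : ‖y - X ω‖ ^ 2 ≤ s ^ 2 := pow_le_pow_left₀ (norm_nonneg _) h5 2
    have h7 : ‖y - y₀‖ ^ 2 ≤ 4 * ‖Y ω - y₀‖ ^ 2 := by
      nlinarith [pow_le_pow_left₀ (norm_nonneg _) hyY 2]
    have h8 : ‖g ω‖ * ‖y - X ω‖ ≤ ‖g ω‖ ^ 2 + s ^ 2 := by
      nlinarith [sq_nonneg (‖g ω‖ - ‖y - X ω‖), sq_nonneg ‖g ω‖, sq_nonneg ‖y - X ω‖]
    have h9 := mul_le_mul_of_nonneg_left h6 (by positivity : 0 ≤ η / 2)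
    have h10 := mul_le_mul_of_nonneg_left h6 (by positivity : 0 ≤ τ / 2)
    have h11 := mul_le_mul_of_nonneg_left h7 hc₁
    rw [norm_sub_rev (X ω) y]
    linarith

end Model

/-- The filtration `k ↦ ℱ (k + k₀)`. -/
def shiftedFiltration {Ω : Type*} {mΩ : MeasurableSpace Ω} (ℱ : Filtration ℕ mΩ) (k₀ : ℕ) :
    Filtration ℕ mΩ where
  seq k := ℱ (k + k₀)
  mono' _ _ h := ℱ.mono (Nat.add_le_add_right h k₀)
  le' k := ℱ.le (k + k₀)

/-- Needed because the first iterate may be infeasible and early step sizes may be too large; a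
shift of the index changes no limit. -/
theorem tendsto_zero_of_eventually_descent {Ω : Type*} [mΩ : MeasurableSpace Ω] {μ : Measure Ω}
    [IsProbabilityMeasure μ] {ℱ : Filtration ℕ mΩ} {E : Type*} [NormedAddCommGroup E]
    {Γ : ℕ → Ω → E} {e W : ℕ → Ω → ℝ} {α : ℕ → ℝ} {c κ : ℝ} (k₀ : ℕ) (hc : 0 ≤ c) (hκ : 0 < κ)
    (hα : ∀ k, 0 < α k)
    (hα_sum : Tendsto (fun N => ∑ k ∈ Finset.range N, α k) atTop atTop)
    (hα_sq : Summable fun k => α k ^ 2)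
    (he : ∀ k ω, 1 ≤ e k ω) (hem : ∀ k, StronglyMeasurable[ℱ k] (e k))
    (hei : ∀ k, Integrable (e k) μ) (hΓm : ∀ k, StronglyMeasurable[ℱ k] (Γ k))
    (hΓe : ∀ k ω, ‖Γ k ω‖ ^ 2 ≤ c * e k ω) (hW0 : ∀ k ω, 0 ≤ W k ω)
    (hW : ∀ k, MemLp (W k) 2 μ)
    (hWc : ∀ k, k₀ ≤ k → μ[fun ω => W k ω ^ 2 | ℱ k] ≤ᵐ[μ] fun ω => c * e k ω)
    (hstep : ∀ k, k₀ ≤ k → ∀ᵐ ω ∂μ, ‖Γ (k + 1) ω - Γ k ω‖ ≤ c * α k * (W k ω + 1))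
    (hdesc : ∀ k, k₀ ≤ k → ∀ A, MeasurableSet[ℱ k] A → ∫ ω in A, e (k + 1) ω ∂μ
      ≤ (1 + c * α k ^ 2) * ∫ ω in A, e k ω ∂μ - κ * α k * ∫ ω in A, ‖Γ k ω‖ ^ 2 ∂μ) :
    Tendsto (fun k => ∫ ω, ‖Γ k ω‖ ∂μ) atTop (𝓝 0) ∧
      ∀ᵐ ω ∂μ, Tendsto (fun k => ‖Γ k ω‖) atTop (𝓝 0) := by
  have hsum : Tendsto (fun N => ∑ k ∈ Finset.range N, α (k + k₀)) atTop atTop := by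
    rw [← not_summable_iff_tendsto_nat_atTop_of_nonneg fun k => (hα _).le] at hα_sum ⊢
    rwa [summable_nat_add_iff (f := α)]
  have hle : ∀ k, k₀ ≤ k + k₀ := fun k => Nat.le_add_left _ _
  have hsucc : ∀ k, k + 1 + k₀ = k + k₀ + 1 := fun k => by ring
  have h := tendsto_zero_of_descent (μ := μ) (ℱ := shiftedFiltration ℱ k₀)
    (Γ := fun k => Γ (k + k₀)) (e := fun k => e (k + k₀)) (W := fun k => W (k + k₀))
    (α := fun k => α (k + k₀)) hc hκ (fun k => hα _) hsum
    ((summable_nat_add_iff (f := fun k => α k ^ 2) k₀).2 hα_sq) (fun k => he _) (fun k => hem _)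
    (fun k => hei _) (fun k => hΓm _) (fun k => hΓe _) (fun k => hW0 _) (fun k => hW _)
    (fun k => hWc _ (hle k)) (fun k => by simpa only [hsucc] using hstep _ (hle k))
    (fun k A hA => by simpa only [hsucc] using hdesc _ (hle k) A hA)
  refine ⟨(tendsto_add_atTop_iff_nat (f := fun k => ∫ ω, ‖Γ k ω‖ ∂μ) k₀).1 h.1, ?_⟩
  filter_upwards [h.2] with ω hω
  exact (tendsto_add_atTop_iff_nat (f := fun k => ‖Γ k ω‖) k₀).1 hω

/-! ### Assembly of the convergence theorem -/

set_option maxHeartbeats 1000000 in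
theorem mainTheorem6 {n : ℕ} {Ω Ξ : Type*} [MeasurableSpace Ω] [MeasurableSpace Ξ]
    (μ : Measure Ω) [IsProbabilityMeasure μ]
    -- the objective `ψ = f + φ`, the models `fm x y ξ = f_x(y, ξ)`, the samples `ξ k`
    (f : EuclideanSpace ℝ (Fin n) → ℝ) (φ : EuclideanSpace ℝ (Fin n) → EReal)
    (fm : EuclideanSpace ℝ (Fin n) → EuclideanSpace ℝ (Fin n) → Ξ → ℝ)
    (ξ : ℕ → Ω → Ξ) (hξ : ∀ k, Measurable (ξ k))
    -- the iterates, the subgradients of the models, the step sizes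
    (x g : ℕ → Ω → EuclideanSpace ℝ (Fin n)) (α : ℕ → ℝ)
    (η ρ τ C D fbar φbar : ℝ) (Lφ Lf L : ℝ≥0)
    (hη : 0 ≤ η) (hρ : 0 ≤ ρ) (hτ : 0 ≤ τ) (hC : 0 ≤ C) (hD : 0 ≤ D)
    -- the iterates are adapted and generated by the model-based method
    (h_adapted : ∀ k, Measurable[sampleFiltration ξ hξ k] (x k))
    (h_update : ∀ k, ∀ᵐ ω ∂μ,
      IsMinOn (fun y => ((fm (x k ω) y (ξ k ω) : ℝ) : EReal) + φ y
        + ((1 / (2 * α k) * ‖y - x k ω‖ ^ 2 : ℝ) : EReal)) Set.univ (x (k + 1) ω))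
    -- one-sided accuracy of the models
    (h_int_self : ∀ k, Integrable (fun ω => fm (x k ω) (x k ω) (ξ k ω)) μ)
    (h_acc_self : ∀ k,
      μ[fun ω => fm (x k ω) (x k ω) (ξ k ω) | sampleFiltration ξ hξ k] =ᵐ[μ] fun ω => f (x k ω))
    (h_int : ∀ y ∈ effDom φ, ∀ k, Integrable (fun ω => fm (x k ω) y (ξ k ω)) μ)
    (h_acc : ∀ y ∈ effDom φ, ∀ k,
      μ[fun ω => fm (x k ω) y (ξ k ω) - f y | sampleFiltration ξ hξ k]
        ≤ᵐ[μ] fun ω => τ / 2 * ‖x k ω - y‖ ^ 2)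
    -- weak convexity of the models
    (h_model : ∀ k, ∀ᵐ ω ∂μ,
      WeaklyConvex η (fun y => ((fm (x k ω) y (ξ k ω) : ℝ) : EReal)))
    -- second moment bound for subgradients of the models
    (h_subgrad : ∀ k, ∀ᵐ ω ∂μ,
      g k ω ∈ frechetSubdiff (fun y => fm (x k ω) y (ξ k ω)) (x k ω))
    (h_g_int : ∀ k, MemLp (g k) 2 μ)
    (h_g_bound : ∀ k,
      μ[fun ω => ‖g k ω‖ ^ 2 | sampleFiltration ξ hξ k]
        ≤ᵐ[μ] fun ω => C * (f (x k ω) - fbar) + D)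
    -- the regularizer
    (hφ_bot : ∀ y, φ y ≠ ⊥) (hφ_proper : (effDom φ).Nonempty)
    (hφ_wc : WeaklyConvex ρ φ) (hφ_lsc : LowerSemicontinuous φ)
    (hφ_lip : LipschitzOnWith Lφ (fun y => (φ y).toReal) (effDom φ))
    (hφ_below : ∀ y ∈ effDom φ, (φbar : EReal) ≤ φ y)
    -- the step sizes
    (hα_pos : ∀ k, 0 < α k) (hα_small : ∀ k, α k * η < 1)
    (hα_sum : Tendsto (fun N => ∑ k ∈ Finset.range N, α k) atTop atTop)
    (hα_sq : Summable fun k => α k ^ 2)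
    -- regularity of `f` and weak convexity of the objective
    (hf : LipschitzScenario f φ fbar Lf ∨ SmoothScenario f fbar L)
    (hψ_wc : WeaklyConvex (η + ρ + τ) (compositeObj f φ)) :
    ∀ θ : ℝ, 0 < θ → θ * (η + ρ + τ) < 1 →
      Differentiable ℝ (moreauEnv θ (compositeObj f φ)) ∧
      (∀ k, Integrable (fun ω => ‖gradient (moreauEnv θ (compositeObj f φ)) (x k ω)‖) μ) ∧
      Tendsto (fun k => ∫ ω, ‖gradient (moreauEnv θ (compositeObj f φ)) (x k ω)‖ ∂μ)
        atTop (𝓝 0) ∧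
      ∀ᵐ ω ∂μ, Tendsto (fun k => ‖gradient (moreauEnv θ (compositeObj f φ)) (x k ω)‖)
        atTop (𝓝 0) := by
  intro θ hθ hθm
  set K := effDom φ with hK
  obtain ⟨y₀, hy₀⟩ := hφ_proper
  have hne : K.Nonempty := ⟨y₀, hy₀⟩
  obtain ⟨hfb, hfc, A, B, hA, hB, hgap⟩ := exists_gap_le hf
  let φr : EuclideanSpace ℝ (Fin n) → ℝ := fun y => (φ y).toReal
  have hKcl : IsClosed K := isClosed_effDom hφ_bot hne hφ_lsc hφ_lip
  have hφb : ∀ y ∈ K, φbar ≤ φr y := fun y hy => by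
    have := hφ_below y hy
    rwa [← EReal.coe_toReal (ne_of_lt hy) (hφ_bot y), EReal.coe_le_coe_iff] at this
  have hFb : ∀ y ∈ K, fbar + φbar ≤ f y + φr y := fun y hy => add_le_add (hfb y hy) (hφb y hy)
  have hψr : ∀ y ∈ K, (compositeObj f φ y).toReal = f y + φr y := fun y hy =>
    toReal_compositeObj hφ_bot hy
  have hdom : effDom (compositeObj f φ) = K := effDom_compositeObj hφ_bot
  have hψc : ConvexOn ℝ K fun y => (f y + φr y) + (η + ρ + τ) / 2 * ‖y‖ ^ 2 := by
    unfold WeaklyConvex at hψ_wc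
    rw [hdom] at hψ_wc
    exact hψ_wc.congr fun y hy => by simp only [hψr y hy]
  obtain ⟨P, hP⟩ : ∃ P, IsProxMap θ (fun y => f y + φr y) K P := 
    exists_isProxMap hθ hKcl hne (hfc.add hφ_lip.continuousOn) hFb
  have hP' : IsProxMap θ (fun y => (compositeObj f φ y).toReal) (effDom (compositeObj f φ)) P := by
    rw [hdom]
    intro x
    refine ⟨(hP x).1, fun y hy => ?_⟩
    simp only [hψr y hy, hψr _ (hP x).1]
    exact (hP x).2 y hy
  set ev : EuclideanSpace ℝ (Fin n) → ℝ := fun z => f (P z) + φr (P z) + 1 / θ / 2 * ‖P z - z‖ ^ 2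
    with hev
  have henv : moreauEnv θ (compositeObj f φ) = ev := by
    funext z
    rw [hP'.moreauEnv_eq (compositeObj_ne_bot hφ_bot), hψr _ (hP z).1]
  have hgradAt : ∀ z, HasGradientAt ev ((1 / θ) • (z - P z)) z := fun z =>
    hP.hasGradientAt_env hθ hθm hψc z
  have hgrad : gradient ev = fun z => (1 / θ) • (z - P z) := gradient_eq hgradAt
  have hdiff : Differentiable ℝ ev := fun z => (hgradAt z).differentiableAt
  rw [henv, hgrad]
  have hPlip := hP.norm_sub_le hθ hθm hψc
  have h1θm : 0 < 1 - θ * (η + ρ + τ) := by linarith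
  have hPcont : Continuous P := by
    refine (LipschitzWith.of_dist_le_mul (K := (1 / (1 - θ * (η + ρ + τ))).toNNReal)
      fun y z => ?_).continuous
    rw [dist_eq_norm, dist_eq_norm, Real.coe_toNNReal _ (by positivity)]
    exact hPlip y z
  have hev_ge : ∀ z, fbar + φbar ≤ ev z := fun z => by
    have : 0 ≤ 1 / θ / 2 * ‖P z - z‖ ^ 2 := by positivity
    have := hFb _ (hP z).1
    simp only [hev]; linarith
  have hev_sq : ∀ z, ‖P z - z‖ ^ 2 ≤ 2 * θ * (ev z - (fbar + φbar)) := fun z =>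
    hP.norm_sub_sq_le hθ hFb z
  let ℱ := sampleFiltration ξ hξ
  have hxm : ∀ k, Measurable (x k) := fun k => (h_adapted k).mono (ℱ.le k) le_rfl
  have hconv : ∀ k, ∀ᵐ ω ∂μ, ConvexOn ℝ Set.univ
      fun y => fm (x k ω) y (ξ k ω) + η / 2 * ‖y‖ ^ 2 := fun k => by
    filter_upwards [h_model k] with ω h
    have hu : effDom (fun y => ((fm (x k ω) y (ξ k ω) : ℝ) : EReal)) = Set.univ :=
      Set.eq_univ_of_forall fun y => EReal.coe_lt_top _
    unfold WeaklyConvex at h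
    rw [hu] at h
    simpa only [EReal.toReal_coe] using h
  have hcont : ∀ k, ∀ᵐ ω ∂μ, Continuous fun y => fm (x k ω) y (ξ k ω) := fun k => by
    filter_upwards [hconv k] with ω h
    have h1 := h.locallyLipschitz.continuous.sub
      (by fun_prop : Continuous fun y : EuclideanSpace ℝ (Fin n) => η / 2 * ‖y‖ ^ 2)
    exact h1.congr fun y => add_sub_cancel_right _ _
  have hsub : ∀ k, ∀ᵐ ω ∂μ, ∀ y, fm (x k ω) (x k ω) (ξ k ω) + inner ℝ (g k ω) (y - x k ω)
      - η / 2 * ‖y - x k ω‖ ^ 2 ≤ fm (x k ω) y (ξ k ω) := fun k => by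
    filter_upwards [hconv k, h_subgrad k] with ω h1 h2
    exact h1.le_of_mem_frechetSubdiff h2
  have hmin : ∀ k, ∀ᵐ ω ∂μ, x (k + 1) ω ∈ K ∧ ∀ y ∈ K, fm (x k ω) (x (k + 1) ω) (ξ k ω)
      + φr (x (k + 1) ω) + 1 / α k / 2 * ‖x (k + 1) ω - x k ω‖ ^ 2
      ≤ fm (x k ω) y (ξ k ω) + φr y + 1 / α k / 2 * ‖y - x k ω‖ ^ 2 := fun k => by
    filter_upwards [h_update k] with ω h
    exact IsMinOn.mem_effDom_and_le (H := fun y => fm (x k ω) y (ξ k ω)) hφ_bot hne h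
  have hxL : ∀ k, MemLp (x k) 2 μ := by
    intro k
    induction k with
    | zero =>
      -- The initial σ-algebra is trivial, so the starting point is deterministic.
      have h0 : ∃ c, x 0 = fun _ => c := by
        have h := h_adapted 0
        have hbot : (sampleFiltration ξ hξ) 0 = ⊥ := by
          show (⨆ i : ℕ, ⨆ _ : i < 0, MeasurableSpace.comap (ξ i) _) = ⊥
          simp
        rw [hbot] at h
        exact stronglyMeasurable_bot_iff.1 h.stronglyMeasurable
      obtain ⟨c, hc⟩ := h0
      rw [hc]
      exact memLp_const c
    | succ k ih =>
      refine memLp_prox_step (φ := φr) (H := fun ω y => fm (x k ω) y (ξ k ω)) (b := φbar)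
        (hα_pos k) (hα_small k) (y₀ := y₀) ih (h_g_int k) (hxm _).aestronglyMeasurable
        (h_int_self k) (h_int y₀ hy₀ k) ?_ ?_ (hsub k)
      · filter_upwards [hmin k] with ω h using hφb _ h.1
      · filter_upwards [hmin k] with ω h using h.2 _ hy₀
  have hPxL : ∀ k, MemLp (fun ω => P (x k ω)) 2 μ := by
    intro k
    refine (((hxL k).sub (memLp_const y₀)).norm.const_mul (1 / (1 - θ * (η + ρ + τ)))
      |>.add (memLp_const ‖P y₀‖)).mono' (hPcont.measurable.comp (hxm k)).aestronglyMeasurable ?_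
    refine Eventually.of_forall fun ω => ?_
    have h1 := hPlip (x k ω) y₀
    have h2 := norm_sub_norm_le (P (x k ω)) (P y₀)
    simp only [Pi.add_apply, Pi.sub_apply]
    linarith
  -- The summand `1` lets additive constants such as `A`, `D` and `Lφ²` be charged to `e`, and makes
  -- division by `e` harmless.
  set e : ℕ → Ω → ℝ := fun k ω => 1 + (ev (x k ω) - (fbar + φbar)) with he
  have he1 : ∀ k ω, 1 ≤ e k ω := fun k ω => by
    have := hev_ge (x k ω)
    simp only [he]; linarith
  have hem : ∀ k, StronglyMeasurable[ℱ k] (e k) := fun k =>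
    (measurable_const.add ((hdiff.continuous.measurable.comp (h_adapted k)).sub
      measurable_const)).stronglyMeasurable
  have hei : ∀ k, Integrable (e k) μ := by
    intro k
    have i1 : Integrable (fun ω => 1 + (f y₀ + φr y₀ + 1 / θ / 2 * ‖y₀ - x k ω‖ ^ 2
        - (fbar + φbar))) μ :=
      (integrable_const _).add (((integrable_const _).add
        ((((memLp_const y₀).sub (hxL k)).integrable_norm_pow two_ne_zero).const_mul _)).sub
        (integrable_const _))
    refine i1.mono' ((hem k).mono (ℱ.le k)).aestronglyMeasurable (Eventually.of_forall fun ω => ?_)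
    rw [Real.norm_eq_abs, abs_of_nonneg (by linarith [he1 k ω])]
    have := (hP (x k ω)).2 y₀ hy₀
    simp only [he, hev]
    linarith
  set Γ : ℕ → Ω → EuclideanSpace ℝ (Fin n) := fun k ω => (1 / θ) • (x k ω - P (x k ω)) with hΓ
  have hΓm : ∀ k, StronglyMeasurable[ℱ k] (Γ k) := fun k =>
    (((h_adapted k).sub (hPcont.measurable.comp (h_adapted k))).const_smul
      (1 / θ)).stronglyMeasurable
  have hΓe : ∀ k ω, ‖Γ k ω‖ ^ 2 ≤ 2 / θ * e k ω := fun k ω => by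
    have h1 := hev_sq (x k ω)
    simp only [hΓ]
    rw [norm_smul, mul_pow, Real.norm_eq_abs, sq_abs, norm_sub_rev]
    have h2 := mul_le_mul_of_nonneg_left h1 (sq_nonneg (1 / θ))
    have h3 : (1 / θ) ^ 2 * (2 * θ * (ev (x k ω) - (fbar + φbar)))
        = 2 / θ * (ev (x k ω) - (fbar + φbar)) := by field_simp
    have h4 : 0 < 2 / θ := by positivity
    simp only [he]
    linarith
  have hΓL : ∀ k, MemLp (Γ k) 2 μ := fun k => ((hxL k).sub (hPxL k)).const_smul (1 / θ)
  -- The envelope gap bounds `f (P z) - fbar` with factor `1` and `‖P z - z‖²` with factor `2 θ`.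
  set c₁ := A + B * (1 + 2 * θ) with hc₁
  have hc₁0 : 0 ≤ c₁ := by positivity
  have hfe : ∀ z ∈ K, f z - fbar ≤ c₁ * (1 + (ev z - (fbar + φbar))) := by
    intro z hz
    have h1 := hgap z hz _ (hP z).1
    have h2 := hev_sq z
    have h3 : f (P z) - fbar ≤ ev z - (fbar + φbar) := by
      have : 0 ≤ 1 / θ / 2 * ‖P z - z‖ ^ 2 := by positivity
      have := hφb _ (hP z).1
      simp only [hev]; linarith
    rw [norm_sub_rev] at h1
    have h4 := mul_le_mul_of_nonneg_left (add_le_add h3 h2) hB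
    have h5 := hev_ge z
    have h6 := mul_nonneg hA (sub_nonneg.2 h5)
    have h7 := mul_nonneg hB hθ.le
    rw [hc₁]
    linarith
  set c₂ := C * c₁ + D with hc₂
  have hc₂0 : 0 ≤ c₂ := by positivity
  have hxK : ∀ k, 1 ≤ k → ∀ᵐ ω ∂μ, x k ω ∈ K := fun k hk => by
    obtain ⟨j, rfl⟩ := Nat.exists_eq_add_of_le' hk
    filter_upwards [hmin j] with ω h using h.1
  have hgc : ∀ k, 1 ≤ k → μ[fun ω => ‖g k ω‖ ^ 2 | ℱ k] ≤ᵐ[μ] fun ω => c₂ * e k ω := fun k hk => by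
    filter_upwards [h_g_bound k, hxK k hk] with ω h1 h2
    refine h1.trans ?_
    have h3 := mul_le_mul_of_nonneg_left (hfe _ h2) hC
    have h4 := mul_le_mul_of_nonneg_left (he1 k ω) hD
    simp only [hc₂, he] at h3 h4 ⊢
    linarith
  set LΓ := 1 / θ * (1 + 1 / (1 - θ * (η + ρ + τ))) with hLΓ
  have hLΓ0 : 0 ≤ LΓ := by positivity
  have hLφ0 : (0 : ℝ) ≤ Lφ := Lφ.2
  -- One constant for four bounds: the noise, `‖Γ‖²`, the increments of `Γ`, and the factor `1 + c
  -- α²`.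
  set c := c₂ + 2 / θ + LΓ * (4 * (1 + Lφ)) + 4 / θ * (c₂ + Lφ ^ 2) with hc
  have t1 : 0 ≤ 2 / θ := by positivity
  have t2 : 0 ≤ LΓ * (4 * (1 + Lφ)) := by positivity
  have t3 : 0 ≤ 4 / θ * (c₂ + Lφ ^ 2) := by positivity
  have hc0 : 0 ≤ c := by positivity
  have he0 : ∀ k ω, 0 ≤ e k ω := fun k ω => by linarith [he1 k ω]
  obtain ⟨k₀, hk₀1, hk₀⟩ : ∃ k₀, 1 ≤ k₀ ∧ ∀ k, k₀ ≤ k → α k * (η + ρ) ≤ 1 / 2 := by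
    have h1 : Tendsto α atTop (𝓝 0) := by
      have := (hα_sq.tendsto_atTop_zero).sqrt
      simpa only [Real.sqrt_zero, Real.sqrt_sq (hα_pos _).le] using this
    have h2 : Tendsto (fun k => α k * (η + ρ)) atTop (𝓝 0) := by
      simpa using h1.mul_const (η + ρ)
    obtain ⟨k₁, hk₁⟩ := eventually_atTop.1 (h2.eventually (gt_mem_nhds one_half_pos))
    exact ⟨max k₁ 1, le_max_right _ _, fun k hk => (hk₁ k ((le_max_left _ _).trans hk)).le⟩
  have hmain := tendsto_zero_of_eventually_descent (μ := μ) (ℱ := ℱ) (Γ := Γ) (e := e)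
    (W := fun k ω => ‖g k ω‖) (α := α) (c := c) (κ := 1 - θ * (η + ρ + τ)) k₀ hc0 h1θm hα_pos
    hα_sum hα_sq he1 hem hei hΓm
    (fun k ω => (hΓe k ω).trans (mul_le_mul_of_nonneg_right (by linarith) (he0 k ω)))
    (fun k ω => norm_nonneg _) (fun k => (h_g_int k).norm)
    (fun k hk => (hgc k (hk₀1.trans hk)).trans (Eventually.of_forall fun ω =>
      mul_le_mul_of_nonneg_right (by linarith) (he0 k ω))) ?_ ?_
  · exact ⟨hdiff, fun k => ((hΓL k).integrable (by norm_num)).norm, hmain.1, hmain.2⟩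
  · intro k hk
    have hαη : α k * η ≤ 1 / 2 := by nlinarith [hk₀ k hk, mul_nonneg (hα_pos k).le hρ]
    filter_upwards [hxK k (hk₀1.trans hk), hmin k, hsub k] with ω h1 h2 h3
    have h4 := prox_step_norm_le (φ := φr) (H := fun y => fm (x k ω) y (ξ k ω)) (hα_pos k) hαη
      hφ_lip h1 h2.1 h2.2 (h3 _)
    have h5 : ‖Γ (k + 1) ω - Γ k ω‖ ≤ LΓ * ‖x (k + 1) ω - x k ω‖ := by
      simp only [hΓ]
      rw [← smul_sub, norm_smul, Real.norm_eq_abs, abs_of_pos (by positivity), hLΓ, mul_assoc]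
      refine mul_le_mul_of_nonneg_left ?_ (by positivity)
      have : x (k + 1) ω - P (x (k + 1) ω) - (x k ω - P (x k ω))
          = (x (k + 1) ω - x k ω) - (P (x (k + 1) ω) - P (x k ω)) := by abel
      rw [this, add_mul, one_mul]
      exact (norm_sub_le _ _).trans (add_le_add_right (hPlip _ _) _)
    have h6 := mul_le_mul_of_nonneg_left h4 hLΓ0
    have h7 : ‖g k ω‖ + Lφ ≤ (1 + Lφ) * (‖g k ω‖ + 1) := by
      nlinarith [mul_nonneg hLφ0 (norm_nonneg (g k ω))]
    have h8 := mul_le_mul_of_nonneg_left h7 (mul_nonneg hLΓ0 (mul_pos four_pos (hα_pos k)).le)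
    have h9 : LΓ * (4 * (1 + Lφ)) * (α k * (‖g k ω‖ + 1)) ≤ c * (α k * (‖g k ω‖ + 1)) :=
      mul_le_mul_of_nonneg_right (by linarith)
        (mul_nonneg (hα_pos k).le (by linarith [norm_nonneg (g k ω)]))
    linarith
  · intro k hk S hS
    have hα0 := hα_pos k
    have hl : 0 < 1 - α k * (η + ρ) := by linarith [hk₀ k hk]
    have hgi : Integrable (fun ω => ‖g k ω‖ ^ 2) μ := (h_g_int k).integrable_norm_pow two_ne_zero
    -- Integrability is inherited from the conditional expectation with which this function agrees
    -- almost surely.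
    have hfx : Integrable (fun ω => f (x k ω)) μ :=
      (integrable_condExp (μ := μ) (m := ℱ k)).congr (h_acc_self k)
    have hfg : ∀ y ∈ K, |f y| ≤ (A + B * (f y₀ - fbar) + |fbar|) + B * ‖y - y₀‖ ^ 2 := by
      intro y hy
      have h1 := hgap y hy y₀ hy₀
      have h2 := hfb y hy
      have h3 := mul_nonneg hB (sub_nonneg.2 (hfb y₀ hy₀))
      have h4 := mul_nonneg hB (sq_nonneg ‖y - y₀‖)
      rw [abs_le]
      constructor <;> linarith [le_abs_self fbar, neg_abs_le fbar]
    obtain ⟨hDi, hDA⟩ := setIntegral_model_accuracy (H := fun ω y => fm (x k ω) y (ξ k ω))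
      (ℱ.le k) hη hτ hB hy₀ (hxL k) (h_g_int k) (h_int_self k) (fun y hy => h_int y hy k)
      (fun y hy => h_acc y hy k) (hcont k) (hsub k) hfc hfg
      (hPcont.measurable.comp (h_adapted k)) (fun ω => (hP (x k ω)).1) (hPxL k)
    have hNi : Integrable (fun ω => fm (x k ω) (x k ω) (ξ k ω) - f (x k ω)) μ :=
      (h_int_self k).sub hfx
    have hNA : ∫ ω in S, (fm (x k ω) (x k ω) (ξ k ω) - f (x k ω)) ∂μ = 0 := by
      rw [integral_sub (h_int_self k).integrableOn hfx.integrableOn,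
        ← setIntegral_condExp (ℱ.le k) (h_int_self k) hS,
        setIntegral_congr_ae (ℱ.le k S hS) ((h_acc_self k).mono fun ω h _ => h), sub_self]
    have hGA : ∫ ω in S, ‖g k ω‖ ^ 2 ∂μ ≤ c₂ * ∫ ω in S, e k ω ∂μ := by
      rw [← setIntegral_condExp (ℱ.le k) hgi hS, ← integral_const_mul]
      exact setIntegral_mono_ae integrable_condExp.integrableOn ((hei k).const_mul _).integrableOn
        (hgc k (hk₀1.trans hk))
    have h := setIntegral_descent (A := S) (e' := e (k + 1)) (e := e k)
      (a := (1 - θ * (η + ρ + τ)) * α k) (b := α k / (θ * (1 - α k * (η + ρ))))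
      (c₁ := 4 / θ * α k ^ 2) (c₂ := 4 / θ * α k ^ 2 * Lφ ^ 2) (by positivity) (by positivity)
      (hei k) (hei (k + 1)) ((hΓL k).integrable_norm_pow two_ne_zero) hDi hNi hgi ?_ (hDA S hS)
      hNA hGA
    · refine h.trans (sub_le_sub_right (mul_le_mul_of_nonneg_right ?_
        (integral_nonneg fun ω => he0 k ω)) _)
      have : 4 / θ * (c₂ + Lφ ^ 2) * α k ^ 2 ≤ c * α k ^ 2 :=
        mul_le_mul_of_nonneg_right (by linarith) (sq_nonneg _)
      linarith
    · filter_upwards [hxK k (hk₀1.trans hk), hmin k, hsub k, hconv k] with ω h1 h2 h3 h4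
      have h5 := hP.env_step_descent hθ hθm hρ hη hψc hα0 (hk₀ k hk) hφ_lip h4 hφ_wc h1 h2.1 h2.2
        (h3 _)
      have h6 : (‖g k ω‖ + Lφ) ^ 2 ≤ 2 * (‖g k ω‖ ^ 2 + Lφ ^ 2 * e k ω) := by
        nlinarith [sq_nonneg (‖g k ω‖ - Lφ), mul_le_mul_of_nonneg_left (he1 k ω) (sq_nonneg (Lφ : ℝ))]
      have h7 := mul_le_mul_of_nonneg_left h6 (by positivity : 0 ≤ 2 / θ * α k ^ 2)
      have h8 : 2 / θ * α k ^ 2 * (2 * (‖g k ω‖ ^ 2 + Lφ ^ 2 * e k ω))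
          = 4 / θ * α k ^ 2 * ‖g k ω‖ ^ 2 + 4 / θ * α k ^ 2 * Lφ ^ 2 * e k ω := by ring
      rw [h8] at h7
      simp only [he, hev, hΓ, Function.comp_apply] at h5 h7 ⊢
      linarith
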